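/- Let $\mathcal H$ be the hypergraph with vertex set $\{z, v_1, v_2, \ldots, v_9\}$ whose edges are $$\{z,v_1,v_3,v_5,v_8\},\quad \{z,v_2,v_4,v_7,v_9\},\quad \{v_1,v_4,v_6,v_8,v_9\},\quad \{v_9,v_1,v_2,v_3,v_4\},$$ $$\{v_i,v_{i+1},v_{i+2},v_{i+3},v_{i+4}\}\quad (1\le i\le 5).$$ Then $\mathcal H$ is a $5$-uniform hypergraph with $10$ vertices and $9$ edges, and the strong Ramsey game $\mathcal R^{(5)}(\mathcal H,\aleph_0)$ is a draw. Here $\mathcal R^{(5)}(\mathcal H,\aleph_0)$ is the following game. The board is the set of all $5$-element subsets of $\mathbb N$ (the edges of the complete $5$-uniform hypergraph on $\mathbb N$). Two players, the first player FP and the second player SP, alternately claim previously unclaimed edges, one edge per move, with FP moving first. A player wins if he is the first to have claimed all edges of a copy of $\mathcal H$, that is, of the image of $\mathcal H$ under an injection of its vertex set into $\mathbb N$. The game is a draw if neither player has a strategy which ensures that he wins after finitely many moves, however the opponent plays. -/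

import Mathlib

/-! ### Strong positional games on an infinite board -/

/-- The two players: `FP` makes the first move, `SP` the second. -/
inductive Player where
  | FP
  | SP

/-- The opponent of a player. -/
def Player.opponent : Player → Player
  | .FP => .SP
  | .SP => .FP

/-- Moves are numbered `0, 1, 2, …`; the players alternate and `FP` makes move `0`. -/
def mover (n : ℕ) : Player := if Even n then .FP else .SP

section StrongGame

variable {X : Type*}

/-- The sequence of the first `n` moves of the play `p`, in the order in which they were made. -/
def history (p : ℕ → X) (n : ℕ) : List X := (List.range n).map p

/-- The set of all elements which the player `P` has claimed after `t` moves (of both players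
together) of the play `p`. -/
def claimed (p : ℕ → X) (P : Player) (t : ℕ) : Set X :=
  {x | ∃ i < t, mover i = P ∧ p i = x}

/-- After `t` moves of the play `p`, the player `P` has claimed all elements of a winning set. -/
def HasWinningSet (F : Set (Finset X)) (p : ℕ → X) (P : Player) (t : ℕ) : Prop :=
  ∃ A ∈ F, (A : Set X) ⊆ claimed p P t

/-- `P` wins the play `p`: at some finite time he has claimed all elements of a winning set,
while his opponent has not done so up to that time (claimed sets only grow, so it
is enough to look at the opponent's set at this one time). What happens after that time is
irrelevant, so plays may be continued forever. -/
def Wins (F : Set (Finset X)) (p : ℕ → X) (P : Player) : Prop :=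
  ∃ t, HasWinningSet F p P t ∧ ¬ HasWinningSet F p P.opponent t

/-- A strategy answers every finite sequence of moves by an element that was not claimed before. -/
structure Strategy (X : Type*) where
  move : List X → X
  legal : ∀ h, move h ∉ h

/-- In the play `p`, all moves of the player `P` are made according to `σ`. -/
def Strategy.Follows (σ : Strategy X) (P : Player) (p : ℕ → X) : Prop :=
  ∀ n, mover n = P → p n = σ.move (history p n)

/-- The player `P` has a strategy which makes him win, after finitely many moves, every play of
the strong game `(X, F)`. As the board is infinite, plays are infinite sequences of
distinct elements. -/
def HasWinningStrategy [Infinite X] (F : Set (Finset X)) (P : Player) : Prop :=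
  ∃ σ : Strategy X, ∀ p : ℕ → X, Function.Injective p → σ.Follows P p → Wins F p P

/-- The strong game `(X, F)` is a draw: no player has a strategy to ensure his win in finitely
many moves. -/
def IsDraw [Infinite X] (F : Set (Finset X)) : Prop :=
  ∀ P : Player, ¬ HasWinningStrategy F P

end StrongGame

/-! ### Strong Ramsey games on the complete uniform hypergraph on `ℕ` -/

/-- Every edge has exactly `k` vertices. -/
def Hypergraph.IsUniform {α : Type*} (H : Hypergraph α) (k : ℕ) : Prop :=
  ∀ e ∈ H.edgeSet, e.encard = k

/-- The edges of the complete `k`-uniform hypergraph with vertex set `ℕ`. -/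
abbrev CompleteEdge (k : ℕ) : Type := {e : Finset ℕ // e.card = k}

instance (k : ℕ) [NeZero k] : Infinite (CompleteEdge k) := by
  refine Infinite.of_injective
    (fun n : ℕ => (⟨(Finset.range k).map (addLeftEmbedding n), by simp⟩ : CompleteEdge k)) ?_
  intro a b hab
  have h : (Finset.range k).map (addLeftEmbedding a) = (Finset.range k).map (addLeftEmbedding b) :=
    congrArg Subtype.val hab
  have hk : 0 < k := Nat.pos_of_ne_zero (NeZero.ne k)
  have ha : a ∈ (Finset.range k).map (addLeftEmbedding b) := by
    rw [← h]
    exact Finset.mem_map.2 ⟨0, by simpa using hk, by simp⟩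
  have hb : b ∈ (Finset.range k).map (addLeftEmbedding a) := by
    rw [h]
    exact Finset.mem_map.2 ⟨0, by simpa using hk, by simp⟩
  simp only [Finset.mem_map, addLeftEmbedding_apply] at ha hb
  obtain ⟨i, -, hi⟩ := ha
  obtain ⟨j, -, hj⟩ := hb
  omega

/-- The winning sets of the strong Ramsey game of `H` on the complete `k`-uniform hypergraph on
`ℕ`: the edge sets of the copies of `H`, that is, of the images of `H` under
injections of its vertex set into `ℕ`. -/
def ramseyWinningSets {α : Type*} (k : ℕ) (H : Hypergraph α) : Set (Finset (CompleteEdge k)) :=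
  {A | ∃ f : α → ℕ, Set.InjOn f H.vertexSet ∧
    (fun e : CompleteEdge k => ((e : Finset ℕ) : Set ℕ)) '' A = (H.image f).edgeSet}

/-! ### The hypergraph -/

/-- The nine edges `r, g, a, b, e₁, …, e₅`; the vertex `z` is `0` and `vᵢ` is `i`. -/
def drawEdges : Finset (Finset (Fin 10)) :=
  {{0, 1, 3, 5, 8},
   {0, 2, 4, 7, 9},
   {1, 4, 6, 8, 9},
   {9, 1, 2, 3, 4},
   {1, 2, 3, 4, 5},
   {2, 3, 4, 5, 6},
   {3, 4, 5, 6, 7},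
   {4, 5, 6, 7, 8},
   {5, 6, 7, 8, 9}}

/-- The hypergraph with the ten vertices `0, …, 9` and the nine edges listed in `drawEdges`. -/
def drawHypergraph : Hypergraph (Fin 10) where
  vertexSet := Set.univ
  edgeSet := {e | ∃ d ∈ drawEdges, (d : Set (Fin 10)) = e}
  subset_vertexSet_of_mem_edgeSet' := fun e _ => Set.subset_univ e

/-! It suffices that a player can keep the opponent from ever being the first to complete a copy
when the opponent moves on a board where this player owns at most one edge.

In seven moves he builds a copy of the core, the seven edges avoiding `z`: first the tight path
`e₁, …, e₅`, then `{v₉, v₁, v₂, v₃, v₄}` and `{v₁, v₄, v₆, v₈, v₉}`, where reflections of the path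
and of the cycle offer a second choice whenever the opponent takes an edge. Now he moves `z` to
fresh vertices: claiming one of the two edges through the new `z` threatens to claim the other one,
the opponent must take it, and this repeats forever. Before that he only has to answer the threats
the opponent has made himself.

The forced replies do not help the opponent. The fresh vertex lies on no other edge of his, while
every vertex other than `z` has degree at least four, so a reply can only be an edge through the
apex of an opponent's copy, whose core he must have owned before. If this happened for both choices
of the threatening edge, he would own two cores which, as he has few edges, share six edges. By
rigidity (seven edges determine a copy, except possibly for the position of `z`, and two cores with
six common edges agree up to a reflection and the exchange of `v₂` and `v₃`) they cannot both go
with the required edges through `z`.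
-/

/-! ### Plays and survival -/

section Play

variable {X : Type*}

theorem history_succ (p : ℕ → X) (n : ℕ) : history p (n + 1) = history p n ++ [p n] := by
  simp [history, List.range_succ]

theorem length_history (p : ℕ → X) (n : ℕ) : (history p n).length = n := by
  simp [history]

theorem injective_of_notMem_history {p : ℕ → X} (h : ∀ n, p n ∉ history p n) :
    Function.Injective p :=
  .of_lt_imp_ne fun _ n hin heq =>
    h n (heq ▸ List.mem_map_of_mem (List.mem_range.2 hin))

theorem exists_injective_play {I : List X → Prop} {R : List X → X → Prop} (nil : I [])
    (step : ∀ h, I h → ∃ x, x ∉ h ∧ R h x ∧ I (h ++ [x])) :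
    ∃ p : ℕ → X, Function.Injective p ∧ ∀ n, I (history p n) ∧ R (history p n) (p n) := by
  have : Nonempty X := let ⟨x, _⟩ := step [] nil; ⟨x⟩
  choose! next fresh rel inv using step
  let hist : ℕ → List X := fun n => Nat.rec [] (fun _ h => h ++ [next h]) n
  have history_eq : ∀ n, history (fun n => next (hist n)) n = hist n := by
    intro n
    induction n with
    | zero => rfl
    | succ n ih => rw [history_succ, ih]
  have hist_inv : ∀ n, I (hist n) := by
    intro n
    induction n with
    | zero => exact nil
    | succ n ih => exact inv _ ih
  refine ⟨fun n => next (hist n), injective_of_notMem_history fun n => ?_, fun n => ?_⟩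
  · rw [history_eq]
    exact fresh _ (hist_inv n)
  · rw [history_eq]
    exact ⟨hist_inv n, rel _ (hist_inv n)⟩

theorem Player.ne_opponent (P : Player) : P ≠ P.opponent := by
  cases P <;> simp [Player.opponent]

theorem Player.opponent_opponent (P : Player) : P.opponent.opponent = P := by
  cases P <;> rfl

theorem mover_eq_or (P : Player) (n : ℕ) : mover n = P ∨ mover n = P.opponent := by
  unfold mover
  split <;> cases P <;> simp [Player.opponent]

theorem mover_succ (n : ℕ) : mover (n + 1) = (mover n).opponent := by
  unfold mover
  by_cases h : Even n <;> simp [h, Nat.even_add_one, Player.opponent]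

open Classical in
/-- The elements which the player `P` has claimed in the course of the moves `h`. -/
noncomputable def ownMoves (P : Player) (h : List X) : Finset X :=
  ((h.zipIdx.filter fun q => mover q.2 = P).map Prod.fst).toFinset

theorem mem_ownMoves {P : Player} {h : List X} {x : X} :
    x ∈ ownMoves P h ↔ ∃ i, mover i = P ∧ h[i]? = some x := by
  simp [ownMoves, List.mem_zipIdx_iff_getElem?, and_comm]

theorem mem_iff_mem_ownMoves (P : Player) {h : List X} {x : X} :
    x ∈ h ↔ x ∈ ownMoves P h ∨ x ∈ ownMoves P.opponent h := by
  simp only [mem_ownMoves, List.mem_iff_getElem?, ← exists_or, ← or_and_right,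
    mover_eq_or, true_and]

theorem coe_ownMoves_history (P : Player) (p : ℕ → X) (n : ℕ) :
    (ownMoves P (history p n) : Set X) = claimed p P n := by
  ext x
  simp only [history, SetLike.mem_coe, mem_ownMoves, List.getElem?_map, Option.map_eq_some_iff,
    List.getElem?_eq_some_iff, List.getElem_range, List.length_range, exists_prop, ↓existsAndEq,
    and_true, claimed, Set.mem_ofPred_eq]
  grind

theorem ownMoves_concat_self [DecidableEq X] {P : Player} {h : List X} (hP : mover h.length = P)
    (x : X) : ownMoves P (h ++ [x]) = insert x (ownMoves P h) := by
  ext y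
  simp [ownMoves, List.zipIdx_append, hP]

theorem ownMoves_concat_of_ne {P : Player} {h : List X} (hP : mover h.length ≠ P) (x : X) :
    ownMoves P (h ++ [x]) = ownMoves P h := by
  ext y
  simp [ownMoves, List.zipIdx_append, hP]

end Play

section Survival

variable {X : Type*}

/-- The set `B` contains a winning set. -/
def ContainsWinningSet (F : Set (Finset X)) (B : Finset X) : Prop := ∃ W ∈ F, W ⊆ B

theorem ContainsWinningSet.mono {F : Set (Finset X)} {A B : Finset X}
    (h : ContainsWinningSet F A) (hAB : A ⊆ B) : ContainsWinningSet F B :=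
  let ⟨W, hW, hWA⟩ := h
  ⟨W, hW, hWA.trans hAB⟩

theorem hasWinningSet_iff (F : Set (Finset X)) (p : ℕ → X) (P : Player) (n : ℕ) :
    HasWinningSet F p P n ↔ ContainsWinningSet F (ownMoves P (history p n)) := by
  simp only [HasWinningSet, ContainsWinningSet, ← coe_ownMoves_history, Finset.coe_subset]

variable [DecidableEq X]

/-- The player owning `A` can play on forever against the player owning `B`, who is to move,
without the latter being the first to complete a winning set. The greatest fixed point accounts
for the infinite length of the game. -/
def Survives (F : Set (Finset X)) (A B : Finset X) : Prop :=
  ∀ x, x ∉ A → x ∉ B →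
    (ContainsWinningSet F (insert x B) → ContainsWinningSet F A) ∧
      ∃ y, y ∉ A ∧ y ∉ insert x B ∧ Survives F (insert y A) (insert x B)
coinductive_fixpoint

/-- The player owning `A`, who is to move, has a move after which he `Survives` against the player
owning `B`. -/
def SurvivesToMove (F : Set (Finset X)) (A B : Finset X) : Prop :=
  ∃ y, y ∉ A ∧ y ∉ B ∧ Survives F (insert y A) B

variable {F : Set (Finset X)} {A B : Finset X}

theorem survives_iff : Survives F A B ↔ ∀ x, x ∉ A → x ∉ B →
    (ContainsWinningSet F (insert x B) → ContainsWinningSet F A) ∧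
      SurvivesToMove F A (insert x B) := by
  rw [Survives.eq_def]
  rfl

theorem Survives.coinduct_upTo (S : Finset X → Finset X → Prop)
    (step : ∀ A B, S A B → ∀ x, x ∉ A → x ∉ B →
      (ContainsWinningSet F (insert x B) → ContainsWinningSet F A) ∧
        ∃ y, y ∉ A ∧ y ∉ insert x B ∧
          (S (insert y A) (insert x B) ∨ Survives F (insert y A) (insert x B)))
    (h : S A B) : Survives F A B := by
  refine Survives.coinduct F (fun A B => S A B ∨ Survives F A B) ?_ A B (Or.inl h)
  rintro A B (hAB | hAB) x hxA hxB
  · exact step A B hAB x hxA hxB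
  · obtain ⟨hwin, y, hyA, hyB, hy⟩ := survives_iff.1 hAB x hxA hxB
    exact ⟨hwin, y, hyA, hyB, Or.inr hy⟩

theorem Survives.of_containsWinningSet [Infinite X] (h : ContainsWinningSet F A) :
    Survives F A B := by
  refine Survives.coinduct F (fun A _ => ContainsWinningSet F A) ?_ A B h
  intro A B hA x _ _
  obtain ⟨y, hy⟩ := Infinite.exists_notMem_finset (A ∪ insert x B)
  obtain ⟨hyA, hyB⟩ := Finset.notMem_union.1 hy
  exact ⟨fun _ => hA, y, hyA, hyB, hA.mono (Finset.subset_insert _ _)⟩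

/-- The player `P` can avoid losing after the moves `h`, and his opponent has not already been the
first to complete a winning set. -/
structure IsSafe (F : Set (Finset X)) (P : Player) (h : List X) : Prop where
  opponent_to_move : mover h.length = P.opponent →
    Survives F (ownMoves P h) (ownMoves P.opponent h)
  to_move : mover h.length = P → SurvivesToMove F (ownMoves P h) (ownMoves P.opponent h)
  containsWinningSet : ContainsWinningSet F (ownMoves P.opponent h) →
    ContainsWinningSet F (ownMoves P h)

theorem IsSafe.concat_of_opponent {P : Player} {h : List X} (hsafe : IsSafe F P h)
    (hmove : mover h.length = P.opponent) {x : X} (hx : x ∉ h) : IsSafe F P (h ++ [x]) := by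
  rw [mem_iff_mem_ownMoves P, not_or] at hx
  have hstep := survives_iff.1 (hsafe.opponent_to_move hmove) x hx.1 hx.2
  have hP : ownMoves P (h ++ [x]) = ownMoves P h :=
    ownMoves_concat_of_ne (hmove ▸ P.ne_opponent.symm) x
  have hO := ownMoves_concat_self hmove x
  have hnext : mover (h ++ [x]).length = P := by
    rw [List.length_append, List.length_singleton, mover_succ, hmove, P.opponent_opponent]
  constructor <;> rw [hP, hO]
  · exact fun h' => absurd (hnext.symm.trans h') P.ne_opponent
  · exact fun _ => hstep.2
  · exact hstep.1

theorem IsSafe.exists_concat {P : Player} {h : List X} (hsafe : IsSafe F P h)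
    (hmove : mover h.length = P) : ∃ y ∉ h, IsSafe F P (h ++ [y]) := by
  obtain ⟨y, hyP, hyO, hy⟩ := hsafe.to_move hmove
  have hP := ownMoves_concat_self hmove y
  have hO : ownMoves P.opponent (h ++ [y]) = ownMoves P.opponent h :=
    ownMoves_concat_of_ne (hmove ▸ P.ne_opponent) y
  have hnext : mover (h ++ [y]).length = P.opponent := by
    rw [List.length_append, List.length_singleton, mover_succ, hmove]
  refine ⟨y, fun h' => ((mem_iff_mem_ownMoves P).1 h').elim hyP hyO, ?_⟩
  constructor <;> rw [hP, hO]
  · exact fun _ => hy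
  · exact fun h' => absurd (h'.symm.trans hnext) P.ne_opponent
  · exact fun h' => (hsafe.containsWinningSet h').mono (Finset.subset_insert _ _)

theorem IsSafe.not_hasWinningStrategy_opponent [Infinite X] {P : Player} (h : IsSafe F P []) :
    ¬ HasWinningStrategy F P.opponent := by
  rintro ⟨σ, hσ⟩
  obtain ⟨p, hp, hsafe⟩ := exists_injective_play
    (R := fun l x => mover l.length = P.opponent → x = σ.move l) h fun l hl => by
      rcases mover_eq_or P l.length with hmove | hmove
      · obtain ⟨y, hy, hsafe⟩ := hl.exists_concat hmove
        exact ⟨y, hy, fun h' => absurd (hmove.symm.trans h') P.ne_opponent, hsafe⟩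
      · exact ⟨σ.move l, σ.legal l, fun _ => rfl, hl.concat_of_opponent hmove (σ.legal l)⟩
  obtain ⟨t, ht, hnot⟩ := hσ p hp fun n hn => (hsafe n).2 (by rwa [length_history])
  rw [P.opponent_opponent] at hnot
  rw [hasWinningSet_iff] at ht hnot
  exact hnot ((hsafe t).1.containsWinningSet ht)

theorem isDraw_of_survives [Infinite X] (toMove : SurvivesToMove F ∅ ∅)
    (survives : Survives F ∅ ∅) : IsDraw F := by
  have hsafe (P : Player) : IsSafe F P [] := ⟨fun _ => survives, fun _ => toMove, id⟩
  exact fun P => P.opponent_opponent ▸ (hsafe P.opponent).not_hasWinningStrategy_opponent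

end Survival

open Finset

/-! ### Rigidity of copies -/

section Copies

variable {α ι : Type*}

theorem containsWinningSet_ramseyWinningSets_iff {k : ℕ} {H : Hypergraph α} {E : ι → Finset α}
    (hV : H.vertexSet = Set.univ) (hE : H.edgeSet = Set.range fun i => (E i : Set α))
    {B : Finset (CompleteEdge k)} : ContainsWinningSet (ramseyWinningSets k H) B ↔
      ∃ θ : α ↪ ℕ, ∀ i, ∃ y ∈ B, y.1 = (E i).map θ := by
  have image_edgeSet (f : α → ℕ) :
      (H.image f).edgeSet = Set.range fun i => f '' (E i : Set α) := by
    change Set.image f '' H.edgeSet = _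
    rw [hE, ← Set.range_comp]
    rfl
  constructor
  · rintro ⟨W, ⟨f, hf, hW⟩, hWB⟩
    rw [hV, Set.injOn_univ] at hf
    refine ⟨⟨f, hf⟩, fun i => ?_⟩
    obtain ⟨y, hy, hyi⟩ : f '' (E i : Set α) ∈ (fun e : CompleteEdge k => (e.1 : Set ℕ)) '' W := by
      rw [hW, image_edgeSet]
      exact ⟨i, rfl⟩
    refine ⟨y, hWB hy, coe_injective ?_⟩
    rw [coe_map]
    exact hyi
  · classical
    rintro ⟨θ, hθ⟩
    refine ⟨{y ∈ B | ∃ i, y.1 = (E i).map θ}, ⟨θ, θ.injective.injOn, ?_⟩, filter_subset _ _⟩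
    rw [image_edgeSet]
    ext s
    constructor
    · rintro ⟨y, hy, rfl⟩
      obtain ⟨-, i, hi⟩ := mem_filter.1 hy
      exact ⟨i, by simp only [hi, coe_map]⟩
    · rintro ⟨i, rfl⟩
      obtain ⟨y, hy, hyi⟩ := hθ i
      exact ⟨y, mem_filter.2 ⟨hy, i, hyi⟩, by simp only [hyi, coe_map]⟩

theorem card_le_card_filter_add_card {β : Type*} [DecidableEq β] {f : ι → β}
    (hf : Function.Injective f) {K : Finset ι} {B D : Finset β}
    (h : ∀ i ∈ K, f i ∈ D ∨ f i ∈ B) : #K ≤ #{i ∈ K | f i ∈ B} + #D := by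
  rw [← card_filter_add_card_filter_not (s := K) fun i => f i ∈ B]
  refine Nat.add_le_add_left (card_le_card_of_injOn f (fun i hi => ?_) hf.injOn) _
  have hi := mem_filter.1 hi
  exact (h i hi.1).resolve_right hi.2

variable {β : Type*} {E : ι → Finset α} {θ θ' : α ↪ β} {K : Finset ι}

theorem exists_eq_of_map_eq (h : ∀ i ∈ K, (E i).map θ' = (E i).map θ) {v : α}
    (hv : ∃ i ∈ K, v ∈ E i) : ∃ w, θ' v = θ w ∧ ∀ i ∈ K, v ∈ E i ↔ w ∈ E i := by
  obtain ⟨i, hi, hvi⟩ := hv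
  obtain ⟨w, -, hw⟩ := mem_map.1 (h i hi ▸ mem_map_of_mem θ' hvi)
  refine ⟨w, hw.symm, fun j hj => ?_⟩
  rw [← mem_map' θ', h j hj, ← hw, mem_map']

variable [DecidableEq α]

/-- The partial index map with graph `q` can be extended by `i ↦ j` without changing the sizes of
intersections of two or three members of the family `E`. -/
def ExtendsTo (E : ι → Finset α) (q : List (ι × ι)) (i j : ι) : Prop :=
  (∀ s ∈ q, #(E i ∩ E s.1) = #(E j ∩ E s.2)) ∧
    ∀ s ∈ q, ∀ t ∈ q, #(E i ∩ E s.1 ∩ E t.1) = #(E j ∩ E s.2 ∩ E t.2)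

instance (E : ι → Finset α) (q : List (ι × ι)) (i j : ι) : Decidable (ExtendsTo E q i j) :=
  inferInstanceAs (Decidable (_ ∧ _))

/-- The graphs of the maps, defined on all but at most `b` members of the list, which preserve the
sizes of intersections of two or three distinct members of the family `E`; a map is found before
its extensions, so that the search is pruned early. -/
def partialIsos {n : ℕ} (E : Fin n → Finset α) :
    List (Fin n) → ℕ → List (List (Fin n × Fin n))
  | [], _ => [[]]
  | i :: l, b => ((partialIsos E l b).flatMap fun q =>
      ((List.finRange n).filter fun j => ExtendsTo E q i j).map fun j => (i, j) :: q) ++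
        if 0 < b then partialIsos E l (b - 1) else []

theorem card_inter_eq_of_map_eq {m : ι → ι}
    (h : ∀ i ∈ K, (E i).map θ' = (E (m i)).map θ) {i j k : ι} (hi : i ∈ K) (hj : j ∈ K)
    (hk : k ∈ K) : #(E i ∩ E j ∩ E k) = #(E (m i) ∩ E (m j) ∩ E (m k)) := by
  classical
  rw [← card_map θ', ← card_map θ]
  simp only [map_inter, h i hi, h j hj, h k hk]

theorem map_filter_mem_partialIsos {n : ℕ} {E : Fin n → Finset α} {K : Finset (Fin n)}
    {m : Fin n → Fin n} (hm : ∀ i ∈ K, ∀ j ∈ K, ∀ k ∈ K,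
      #(E i ∩ E j ∩ E k) = #(E (m i) ∩ E (m j) ∩ E (m k))) (l : List (Fin n)) (b : ℕ)
    (hb : (l.filter fun i => i ∉ K).length ≤ b) :
    ((l.filter fun i => i ∈ K).map fun i => (i, m i)) ∈ partialIsos E l b := by
  induction l generalizing b with
  | nil => exact List.mem_singleton_self _
  | cons i l ih =>
    rw [partialIsos, List.mem_append]
    by_cases hi : i ∈ K
    · left
      rw [List.filter_cons_of_neg (by simpa using hi)] at hb
      rw [List.filter_cons_of_pos (by simpa using hi), List.map_cons]
      refine List.mem_flatMap.2 ⟨_, ih b hb, List.mem_map_of_mem (List.mem_filter.2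
        ⟨List.mem_finRange _, decide_eq_true ?_⟩)⟩
      simp only [ExtendsTo, List.forall_mem_map, List.mem_filter, decide_eq_true_eq, and_imp]
      refine ⟨fun j _ hj => ?_, fun j _ hj k _ hk => hm i hi j hj k hk⟩
      simpa only [inter_self, inter_right_comm] using hm i hi i hi j hj
    · right
      rw [List.filter_cons_of_pos (by simpa using hi), List.length_cons] at hb
      rw [List.filter_cons_of_neg (by simpa using hi)]
      obtain ⟨b, rfl⟩ := Nat.exists_eq_add_one_of_ne_zero (by lia : b ≠ 0)
      exact ih b (by lia)

theorem exists_mem_partialIsos {n b : ℕ} {E : Fin n → Finset α} {K S : Finset (Fin n)}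
    {m : Fin n → Fin n} (hKS : K ⊆ S) (hb : #S ≤ #K + b)
    (h : ∀ i ∈ K, (E i).map θ' = (E (m i)).map θ) :
    ∃ q ∈ partialIsos E ((List.finRange n).filter fun i => i ∈ S) b, ∀ i ∈ K, (i, m i) ∈ q := by
  refine ⟨_, map_filter_mem_partialIsos (E := E) (K := K) (m := m)
    (fun i hi j hj k hk => card_inter_eq_of_map_eq h hi hj hk) _ b ?_, fun i hi => ?_⟩
  · have hsdiff : (((List.finRange n).filter fun i => i ∈ S).filter fun i => i ∉ K).toFinset =
        S \ K := by
      ext i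
      simp [and_comm]
    rw [← List.toFinset_card_of_nodup (((List.nodup_finRange n).filter _).filter _), hsdiff,
      card_sdiff_of_subset hKS]
    lia
  · simpa [hi] using hKS hi

end Copies

namespace drawHypergraph

/-- The edges of `drawHypergraph` in the order of the listing in `drawEdges`. -/
def edge : Fin 9 → Finset (Fin 10) :=
  ![{0, 1, 3, 5, 8}, {0, 2, 4, 7, 9}, {1, 4, 6, 8, 9}, {9, 1, 2, 3, 4}, {1, 2, 3, 4, 5},
    {2, 3, 4, 5, 6}, {3, 4, 5, 6, 7}, {4, 5, 6, 7, 8}, {5, 6, 7, 8, 9}]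

theorem card_edge : ∀ i, #(edge i) = 5 := by decide

theorem edge_injective : Function.Injective edge := by decide

theorem edgeSet_eq_range :
    drawHypergraph.edgeSet = Set.range fun i => (edge i : Set (Fin 10)) := by
  have drawEdges_eq : drawEdges = univ.image edge := by decide
  ext e
  change (∃ d ∈ drawEdges, (d : Set (Fin 10)) = e) ↔ _
  simp only [drawEdges_eq, mem_image, mem_univ, true_and, exists_exists_eq_and, Set.mem_range]

theorem isUniform : drawHypergraph.IsUniform 5 := by
  intro e he
  rw [edgeSet_eq_range] at he
  obtain ⟨i, rfl⟩ := he
  simp only [Set.encard_coe_eq_coe_finsetCard, card_edge, Nat.cast_ofNat]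

theorem ncard_vertexSet : drawHypergraph.vertexSet.ncard = 10 :=
  (Set.ncard_univ _).trans (Nat.card_fin 10)

theorem ncard_edgeSet : drawHypergraph.edgeSet.ncard = 9 := by
  have hinj : Function.Injective fun i => (edge i : Set (Fin 10)) :=
    coe_injective.comp edge_injective
  rw [edgeSet_eq_range, ← Set.image_univ, Set.ncard_image_of_injective _ hinj, Set.ncard_univ,
    Nat.card_fin]

/-- The winning sets of the game played on `drawHypergraph`. -/
abbrev winningSets : Set (Finset (CompleteEdge 5)) := ramseyWinningSets 5 drawHypergraph

/-- The edge with index `i` of the copy of `drawHypergraph` given by `θ`. -/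
def copyEdge (θ : Fin 10 ↪ ℕ) (i : Fin 9) : CompleteEdge 5 :=
  ⟨(edge i).map θ, by rw [card_map, card_edge]⟩

section CopyEdge

variable {θ θ' : Fin 10 ↪ ℕ} {i j : Fin 9}

theorem copyEdge_injective (θ : Fin 10 ↪ ℕ) : Function.Injective (copyEdge θ) := fun _ _ h =>
  edge_injective (map_injective θ (congrArg Subtype.val h))

theorem mem_copyEdge {v : Fin 10} : θ v ∈ (copyEdge θ i).1 ↔ v ∈ edge i :=
  mem_map' θ

theorem copyEdge_congr (h : ∀ v ∈ edge i, θ v = θ' v) : copyEdge θ i = copyEdge θ' i := by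
  refine Subtype.ext (coe_injective ?_)
  simp only [copyEdge, coe_map]
  exact Set.image_congr h

theorem copyEdge_trans {τ : Equiv.Perm (Fin 10)} (h : (edge i).map τ.toEmbedding = edge j) :
    copyEdge (τ.toEmbedding.trans θ) i = copyEdge θ j :=
  Subtype.ext (by simp only [copyEdge, ← h, map_map])

theorem containsWinningSet_iff {B : Finset (CompleteEdge 5)} :
    ContainsWinningSet winningSets B ↔ ∃ θ : Fin 10 ↪ ℕ, ∀ i, copyEdge θ i ∈ B := by
  rw [containsWinningSet_ramseyWinningSets_iff rfl edgeSet_eq_range]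
  refine exists_congr fun θ => forall_congr' fun i => ⟨?_, fun h => ⟨_, h, rfl⟩⟩
  rintro ⟨y, hy, hyi⟩
  rwa [show copyEdge θ i = y from Subtype.ext hyi.symm]

end CopyEdge

/-- The indices of the edges that do not contain the vertex `0`. -/
def core : Finset (Fin 9) := {i | 0 ∉ edge i}

theorem mem_core {i : Fin 9} : i ∈ core ↔ 0 ∉ edge i := by
  rw [core, mem_filter_univ]

theorem card_core : #core = 7 := by decide

theorem four_le_degree : ∀ v ≠ 0, 4 ≤ #{i | v ∈ edge i} := by decide

theorem three_le_core_degree : ∀ v ≠ 0, 3 ≤ #{i ∈ core | v ∈ edge i} := by decide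

theorem three_le_card_separating :
    ∀ v w : Fin 10, v ≠ w → 3 ≤ #{i | ¬(v ∈ edge i ↔ w ∈ edge i)} := by decide

theorem two_le_card_core_separating : ∀ v ≠ 0, ∀ w ≠ v, w ≠ Equiv.swap 2 3 v →
    2 ≤ #{i ∈ core | ¬(v ∈ edge i ↔ w ∈ edge i)} := by decide

/-- The reflection of the cyclic tight path `v₉v₁v₂⋯v₈`, which maps each core edge except for
`{v₁, v₄, v₆, v₈, v₉}` to a core edge. -/
def cycleReflection : Equiv.Perm (Fin 10) :=
  Function.Involutive.toPerm ![0, 8, 7, 6, 5, 4, 3, 2, 1, 9] fun v => by decide +revert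

/-- The permutations of the vertices that can arise when two cores share all but one edge. -/
def coreSymmetries : Finset (Equiv.Perm (Fin 10)) := {1, cycleReflection}

theorem mem_coreSymmetries {τ : Equiv.Perm (Fin 10)} :
    τ ∈ coreSymmetries ↔ τ = 1 ∨ τ = cycleReflection := by
  rw [coreSymmetries, mem_insert, mem_singleton]

theorem coreSymmetry_zero {τ : Equiv.Perm (Fin 10)} (hτ : τ ∈ coreSymmetries) : τ 0 = 0 := by
  rcases mem_coreSymmetries.1 hτ with rfl | rfl <;> rfl

theorem eq_of_mem_partialIsos :
    ∀ q ∈ partialIsos edge ((List.finRange 9).filter fun i => i ∈ univ) 2,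
      ∀ s ∈ q, s.1 = s.2 := by decide +kernel

theorem eq_or_map_eq_of_mem_partialIsos :
    ∀ q ∈ partialIsos edge ((List.finRange 9).filter fun i => i ∈ core) 1,
      (∀ s ∈ q, s.1 = s.2) ∨
        ∀ s ∈ q, (edge s.1).map cycleReflection.toEmbedding = edge s.2 := by decide +kernel

theorem exists_coreSymmetry_of_mem_partialIsos {q : List (Fin 9 × Fin 9)}
    (hq : q ∈ partialIsos edge ((List.finRange 9).filter fun i => i ∈ core) 1) :
    ∃ τ ∈ coreSymmetries, ∀ s ∈ q, (edge s.1).map τ.toEmbedding = edge s.2 := by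
  rcases eq_or_map_eq_of_mem_partialIsos q hq with h | h
  · exact ⟨1, mem_coreSymmetries.2 (Or.inl rfl), fun s hs => h s hs ▸ map_refl⟩
  · exact ⟨cycleReflection, mem_coreSymmetries.2 (Or.inr rfl), h⟩

section Rigidity

variable {θ θ' : Fin 10 ↪ ℕ} {K : Finset (Fin 9)} {v : Fin 10}

theorem copyEdge_eq_of_seven_le (hK : 7 ≤ #K)
    (h : ∀ i ∈ K, ∃ j, copyEdge θ' i = copyEdge θ j) :
    ∀ i ∈ K, copyEdge θ' i = copyEdge θ i := by
  choose! m hm using h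
  obtain ⟨q, hq, hqm⟩ := exists_mem_partialIsos (b := 2) (subset_univ K)
    (by rw [card_univ, Fintype.card_fin]; lia) fun i hi => congrArg Subtype.val (hm i hi)
  intro i hi
  have heq : i = m i := eq_of_mem_partialIsos q hq _ (hqm i hi)
  rw [hm i hi, ← heq]

theorem apply_eq_of_seven_le (hK : 7 ≤ #K) (h : ∀ i ∈ K, copyEdge θ' i = copyEdge θ i)
    (hv : ∃ i ∈ K, v ∈ edge i) : θ' v = θ v := by
  obtain ⟨w, hw, hmem⟩ := exists_eq_of_map_eq (fun i hi => congrArg Subtype.val (h i hi)) hv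
  rw [hw]
  by_contra hne
  obtain ⟨i, hi⟩ := inter_nonempty_of_card_lt_card_add_card (subset_univ K)
    (subset_univ {i | ¬(v ∈ edge i ↔ w ∈ edge i)}) (by
      have := three_le_card_separating v w fun hvw => hne (congrArg θ hvw).symm
      rw [card_univ, Fintype.card_fin]
      lia)
  rw [mem_inter, mem_filter_univ] at hi
  exact hi.2 (hmem i hi.1)

theorem apply_eq_of_seven_le_of_ne_zero (hK : 7 ≤ #K)
    (h : ∀ i ∈ K, copyEdge θ' i = copyEdge θ i) (hv : v ≠ 0) : θ' v = θ v := by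
  obtain ⟨i, hi⟩ := inter_nonempty_of_card_lt_card_add_card (subset_univ K)
    (subset_univ {i | v ∈ edge i}) (by
      have := four_le_degree v hv
      rw [card_univ, Fintype.card_fin]
      lia)
  rw [mem_inter, mem_filter_univ] at hi
  exact apply_eq_of_seven_le hK h ⟨i, hi⟩

theorem exists_coreSymmetry_of_six_le (hKc : K ⊆ core) (hK : 6 ≤ #K)
    (h : ∀ i ∈ K, ∃ j, copyEdge θ' i = copyEdge θ j) :
    ∃ τ ∈ coreSymmetries, ∀ i ∈ K, ∃ j ∈ core,
      (edge i).map τ.toEmbedding = edge j ∧ copyEdge θ' i = copyEdge θ j := by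
  choose! m hm using h
  obtain ⟨q, hq, hqm⟩ := exists_mem_partialIsos (b := 1) hKc
    (by rw [card_core]; lia) fun i hi => congrArg Subtype.val (hm i hi)
  obtain ⟨τ, hτ, hτq⟩ := exists_coreSymmetry_of_mem_partialIsos hq
  refine ⟨τ, hτ, fun i hi => ⟨m i, ?_, hτq _ (hqm i hi), hm i hi⟩⟩
  rw [mem_core, ← hτq _ (hqm i hi), ← coreSymmetry_zero hτ]
  exact fun h0 => mem_core.1 (hKc hi) ((mem_map' τ.toEmbedding).1 h0)

theorem apply_eq_or_of_six_le (hKc : K ⊆ core) (hK : 6 ≤ #K)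
    (h : ∀ i ∈ K, copyEdge θ' i = copyEdge θ i) (hv : v ≠ 0) :
    θ' v = θ v ∨ θ' v = θ (Equiv.swap 2 3 v) := by
  obtain ⟨i, hi⟩ := inter_nonempty_of_card_lt_card_add_card hKc
    (filter_subset (v ∈ edge ·) core) (by
      have := three_le_core_degree v hv
      rw [card_core]
      lia)
  simp only [mem_inter, mem_filter] at hi
  obtain ⟨w, hw, hmem⟩ := exists_eq_of_map_eq (fun i hi => congrArg Subtype.val (h i hi))
    ⟨i, hi.1, hi.2.2⟩
  rw [hw]
  by_contra! hne
  obtain ⟨k, hk⟩ := inter_nonempty_of_card_lt_card_add_card hKc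
    (filter_subset (fun i => ¬(v ∈ edge i ↔ w ∈ edge i)) core) (by
      have := two_le_card_core_separating v hv w (fun h => hne.1 (congrArg θ h))
        fun h => hne.2 (congrArg θ h)
      rw [card_core]
      lia)
  simp only [mem_inter, mem_filter] at hk
  exact hk.2.2 (hmem k hk.1)

end Rigidity

/-! ### Moving the apex -/

/-- `edge s` and `edge t` are the two edges through the vertex `0`, in either order. -/
structure IsApexPair (s t : Fin 9) : Prop where
  ne : s ≠ t
  left : 0 ∈ edge s
  right : 0 ∈ edge t

/-- All edges of the copy `θ` that do not contain its apex `θ 0` have been claimed. -/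
def OwnsCore (θ : Fin 10 ↪ ℕ) (A : Finset (CompleteEdge 5)) : Prop :=
  ∀ i ∈ core, copyEdge θ i ∈ A

/-- The apex `θ 0` of the copy `θ` can be replaced by `z`. -/
def IsFreeApex (θ : Fin 10 ↪ ℕ) (z : ℕ) : Prop := ∀ v ≠ 0, θ v ≠ z

/-- The copy `θ` with its apex moved to `z`; this is meant for `z` with `IsFreeApex θ z`. -/
def moveApex (θ : Fin 10 ↪ ℕ) (z : ℕ) : Fin 10 ↪ ℕ := θ.setValue 0 z

/-- The vertices of the edge `copyEdge θ s` through the apex other than the apex itself. -/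
def side (θ : Fin 10 ↪ ℕ) (s : Fin 9) : Finset ℕ := ((edge s).erase 0).map θ

theorem OwnsCore.mono {θ : Fin 10 ↪ ℕ} {A A' : Finset (CompleteEdge 5)} (h : OwnsCore θ A)
    (hA : A ⊆ A') : OwnsCore θ A' :=
  fun i hi => hA (h i hi)

section ApexPair

variable {s t : Fin 9}

theorem IsApexPair.symm (h : IsApexPair s t) : IsApexPair t s :=
  ⟨h.ne.symm, h.right, h.left⟩

theorem IsApexPair.eq_or_eq_or_mem_core (h : IsApexPair s t) (i : Fin 9) :
    i = s ∨ i = t ∨ i ∈ core := by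
  have cover : ∀ s t i : Fin 9, s ≠ t → 0 ∈ edge s → 0 ∈ edge t → i = s ∨ i = t ∨ i ∈ core := by
    decide
  exact cover s t i h.ne h.left h.right

theorem exists_isApexPair (hs : 0 ∈ edge s) : ∃ t, IsApexPair s t := by
  have partner : ∀ s : Fin 9, 0 ∈ edge s → ∃ t, s ≠ t ∧ 0 ∈ edge t := by decide
  obtain ⟨t, hne, ht⟩ := partner s hs
  exact ⟨t, hne, hs, ht⟩

theorem IsApexPair.disjoint_side (h : IsApexPair s t) (θ : Fin 10 ↪ ℕ) :
    Disjoint (side θ s) (side θ t) := by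
  have disjoint : ∀ s t : Fin 9, s ≠ t → 0 ∈ edge s → 0 ∈ edge t →
      Disjoint ((edge s).erase 0) ((edge t).erase 0) := by decide
  exact (disjoint_map θ).2 (disjoint s t h.ne h.left h.right)

end ApexPair

section MoveApex

variable {θ θ' : Fin 10 ↪ ℕ} {s t : Fin 9} {z z' : ℕ}

theorem isFreeApex_apply_zero (θ : Fin 10 ↪ ℕ) : IsFreeApex θ (θ 0) :=
  fun _ hv => θ.injective.ne hv

theorem IsFreeApex.congr (h : ∀ v ≠ 0, θ' v = θ v) (hz : IsFreeApex θ' z) : IsFreeApex θ z :=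
  fun v hv => h v hv ▸ hz v hv

theorem notMem_side (h : IsFreeApex θ z) : z ∉ side θ s := by
  intro hz
  obtain ⟨v, hv, hvz⟩ := mem_map.1 hz
  exact h v (ne_of_mem_erase hv) hvz

theorem side_congr (h : ∀ v ∈ (edge s).erase 0, θ' v = θ v) : side θ' s = side θ s := by
  refine coe_injective ?_
  simp only [side, coe_map]
  exact Set.image_congr h

theorem coe_copyEdge_eq_insert (hs : 0 ∈ edge s) :
    (copyEdge θ s).1 = insert (θ 0) (side θ s) := by
  rw [side, ← map_insert, insert_erase hs]
  rfl

theorem copyEdge_eq_iff_side_eq (hs : 0 ∈ edge s) (ht : 0 ∈ edge t) (h0 : θ' 0 = θ 0) :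
    copyEdge θ' s = copyEdge θ t ↔ side θ' s = side θ t := by
  have hs' : θ 0 ∉ side θ' s := h0 ▸ notMem_side (isFreeApex_apply_zero θ')
  have ht' : θ 0 ∉ side θ t := notMem_side (isFreeApex_apply_zero θ)
  rw [Subtype.ext_iff, coe_copyEdge_eq_insert hs, coe_copyEdge_eq_insert ht, h0]
  exact ⟨fun h => by rw [← erase_insert hs', h, erase_insert ht'], fun h => by rw [h]⟩

theorem moveApex_zero (θ : Fin 10 ↪ ℕ) (z : ℕ) : moveApex θ z 0 = z :=
  Function.Embedding.setValue_eq θ 0 z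

theorem moveApex_of_ne (h : IsFreeApex θ z) {v : Fin 10} (hv : v ≠ 0) :
    moveApex θ z v = θ v :=
  Function.Embedding.setValue_eq_of_ne hv (h v hv)

theorem eq_moveApex (h : ∀ v ≠ 0, θ' v = θ v) : θ' = moveApex θ (θ' 0) := by
  refine DFunLike.ext _ _ fun v => ?_
  by_cases hv : v = 0
  · rw [hv, moveApex_zero]
  · rw [moveApex_of_ne ((isFreeApex_apply_zero θ').congr h) hv, h v hv]

theorem copyEdge_moveApex_of_mem_core (h : IsFreeApex θ z) {i : Fin 9} (hi : i ∈ core) :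
    copyEdge (moveApex θ z) i = copyEdge θ i :=
  copyEdge_congr fun _ hv => moveApex_of_ne h (ne_of_mem_of_not_mem hv (mem_core.1 hi))

theorem side_moveApex (h : IsFreeApex θ z) : side (moveApex θ z) s = side θ s :=
  side_congr fun _ hv => moveApex_of_ne h (ne_of_mem_erase hv)

theorem mem_copyEdge_moveApex (hs : 0 ∈ edge s) : z ∈ (copyEdge (moveApex θ z) s).1 := by
  rw [coe_copyEdge_eq_insert hs, moveApex_zero]
  exact mem_insert_self _ _

theorem eq_of_mem_copyEdge_moveApex (hs : 0 ∈ edge s) (hz : IsFreeApex θ z)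
    (hz' : IsFreeApex θ z') (h : z ∈ (copyEdge (moveApex θ z') s).1) : z = z' := by
  rw [coe_copyEdge_eq_insert hs, moveApex_zero, side_moveApex hz', mem_insert] at h
  exact h.resolve_right (notMem_side hz)

theorem OwnsCore.containsWinningSet {A : Finset (CompleteEdge 5)} (h : OwnsCore θ A)
    (hz : IsFreeApex θ z) (hst : IsApexPair s t) (hs : copyEdge (moveApex θ z) s ∈ A)
    (ht : copyEdge (moveApex θ z) t ∈ A) : ContainsWinningSet winningSets A := by
  refine containsWinningSet_iff.2 ⟨moveApex θ z, fun i => ?_⟩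
  rcases hst.eq_or_eq_or_mem_core i with rfl | rfl | hi
  · exact hs
  · exact ht
  · rw [copyEdge_moveApex_of_mem_core hz hi]
    exact h i hi

end MoveApex

section Degree

variable {θ : Fin 10 ↪ ℕ} {B : Finset (CompleteEdge 5)} {x : CompleteEdge 5} {z : ℕ} {i : Fin 9}

theorem card_filter_mem_edge_le {v : Fin 10} {K : Finset (Fin 9)}
    {D : Finset (CompleteEdge 5)} (h : ∀ i ∈ K, v ∈ edge i → copyEdge θ i ∈ D) :
    #{i ∈ K | v ∈ edge i} ≤ #D :=
  card_le_card_of_injOn (copyEdge θ)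
    (fun i hi => let ⟨hiK, hv⟩ := mem_filter.1 hi; h i hiK hv) (copyEdge_injective θ).injOn

theorem apply_zero_eq_of_forall_mem_eq {e : Fin 9}
    (hθ : ∀ j ≠ e, copyEdge θ j ∈ insert x B) (hz : z ∈ (copyEdge θ i).1)
    (huniq : ∀ y ∈ B, z ∈ y.1 → y = copyEdge θ i) : θ 0 = z := by
  obtain ⟨v, -, rfl⟩ := mem_map.1 hz
  by_contra hne
  have hlow : #{j ∈ univ | v ∈ edge j} ≤ #{x, copyEdge θ i, copyEdge θ e} :=
    card_filter_mem_edge_le fun j _ hj => by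
      rw [mem_insert, mem_insert, mem_singleton]
      by_cases hje : j = e
      · exact Or.inr (Or.inr (congrArg _ hje))
      · exact (mem_insert.1 (hθ j hje)).imp_right fun h =>
          Or.inl (huniq _ h (mem_copyEdge.2 hj))
  have hhigh := four_le_degree v fun h => hne (congrArg θ h.symm)
  have hthree := card_le_three (a := x) (b := copyEdge θ i) (c := copyEdge θ e)
  lia

theorem OwnsCore.not_forall_mem_eq (hθ : OwnsCore θ (insert x B)) (hi : i ∈ core)
    (hz : z ∈ (copyEdge θ i).1) : ¬ ∀ y ∈ B, z ∈ y.1 → y = copyEdge θ i := by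
  intro huniq
  obtain ⟨v, hv, rfl⟩ := mem_map.1 hz
  have hlow : #{j ∈ core | v ∈ edge j} ≤ #{x, copyEdge θ i} :=
    card_filter_mem_edge_le fun j hj hvj => by
      rw [mem_insert, mem_singleton]
      exact (mem_insert.1 (hθ j hj)).imp_right fun h => huniq _ h (mem_copyEdge.2 hvj)
  have hhigh := three_le_core_degree v (ne_of_mem_of_not_mem hv (mem_core.1 hi))
  have htwo := card_le_two (a := x) (b := copyEdge θ i)
  lia

end Degree

section Harmless

variable {ψ ψ' : Fin 10 ↪ ℕ} {C : Finset (CompleteEdge 5)} {s t : Fin 9}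

theorem exists_common_core (hC : #C ≤ 8) (h : OwnsCore ψ C) (h' : OwnsCore ψ' C) :
    ∃ K ⊆ core, 6 ≤ #K ∧ ∀ i ∈ K, ∃ j, copyEdge ψ' i = copyEdge ψ j := by
  have hcard : #core ≤ #{i ∈ core | copyEdge ψ' i ∈ core.image (copyEdge ψ)} +
      #(C \ core.image (copyEdge ψ)) :=
    card_le_card_filter_add_card (copyEdge_injective ψ') fun i hi => by
      rw [mem_sdiff]
      exact (em _).symm.imp_left fun hn => ⟨h' i hi, hn⟩
  rw [card_sdiff_of_subset (image_subset_iff.2 h), card_image_of_injective _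
    (copyEdge_injective ψ), card_core] at hcard
  refine ⟨{i ∈ core | copyEdge ψ' i ∈ core.image (copyEdge ψ)}, filter_subset _ _, by lia,
    fun i hi => ?_⟩
  obtain ⟨j, -, hj⟩ := mem_image.1 (mem_filter.1 hi).2
  exact ⟨j, hj.symm⟩

theorem exists_coreSymmetry_apply_eq_or (hC : #C ≤ 8) (h : OwnsCore ψ C) (h' : OwnsCore ψ' C) :
    ∃ τ ∈ coreSymmetries, ∀ v ≠ 0, ψ' v = ψ (τ v) ∨ ψ' v = ψ (τ (Equiv.swap 2 3 v)) := by
  obtain ⟨K, hKc, hK, hcommon⟩ := exists_common_core hC h h'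
  obtain ⟨τ, hτ, hmap⟩ := exists_coreSymmetry_of_six_le hKc hK hcommon
  refine ⟨τ, hτ, fun v hv => ?_⟩
  refine apply_eq_or_of_six_le (θ := τ.toEmbedding.trans ψ) hKc hK (fun i hi => ?_) hv
  obtain ⟨j, -, hj, heq⟩ := hmap i hi
  rw [heq, copyEdge_trans hj]

theorem exists_mem_edge_of_ne_one_or_eq {τ : Equiv.Perm (Fin 10)} (hτ : τ ∈ coreSymmetries)
    (hs : 0 ∈ edge s) (ht : 0 ∈ edge t) (h : τ ≠ 1 ∨ s = t) :
    ∃ v ∈ (edge t).erase 0, Equiv.swap 2 3 v = v ∧ τ v ∈ (edge s).erase 0 := by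
  rcases mem_coreSymmetries.1 hτ with rfl | rfl
  · obtain rfl := h.resolve_left fun h => h rfl
    have fixed : ∀ s : Fin 9, 0 ∈ edge s → ∃ v ∈ (edge s).erase 0, Equiv.swap 2 3 v = v := by
      decide
    obtain ⟨v, hv, hfix⟩ := fixed s hs
    exact ⟨v, hv, hfix, hv⟩
  · revert s t
    decide

theorem IsApexPair.swap_eq_or_mem (h : IsApexPair s t) {v : Fin 10} (hv : v ∈ (edge t).erase 0) :
    Equiv.swap 2 3 v = v ∨ Equiv.swap 2 3 v ∈ (edge s).erase 0 := by
  have swap : ∀ s t : Fin 9, s ≠ t → 0 ∈ edge s → 0 ∈ edge t → ∀ v ∈ (edge t).erase 0,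
      Equiv.swap 2 3 v = v ∨ Equiv.swap 2 3 v ∈ (edge s).erase 0 := by decide
  exact swap s t h.ne h.left h.right v hv

theorem side_eq_of_disjoint (hC : #C ≤ 8) (h : OwnsCore ψ C) (h' : OwnsCore ψ' C)
    (hs : 0 ∈ edge s) (ht : 0 ∈ edge t) (hdisj : Disjoint (side ψ s) (side ψ' t)) :
    IsApexPair s t ∧ side ψ' t = side ψ t := by
  have hne : ∀ v ∈ (edge t).erase 0, ∀ w ∈ (edge s).erase 0, ψ' v ≠ ψ w := fun v hv w hw heq =>
    disjoint_left.1 hdisj (mem_map_of_mem ψ hw) (heq ▸ mem_map_of_mem ψ' hv)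
  obtain ⟨τ, hτ, happly⟩ := exists_coreSymmetry_apply_eq_or hC h h'
  have hpair : τ = 1 ∧ s ≠ t := by
    by_contra! hcon
    obtain ⟨v, hv, hfix, hτv⟩ := exists_mem_edge_of_ne_one_or_eq hτ hs ht (or_iff_not_imp_left.2
      fun hτ' => hcon (not_not.1 hτ'))
    have := happly v (ne_of_mem_erase hv)
    rw [hfix, or_self] at this
    exact hne v hv _ hτv this
  obtain ⟨rfl, hst⟩ := hpair
  have hst : IsApexPair s t := ⟨hst, hs, ht⟩
  refine ⟨hst, side_congr fun v hv => ?_⟩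
  rcases hst.swap_eq_or_mem hv with hfix | hmem
  · have := happly v (ne_of_mem_erase hv)
    rwa [hfix, or_self] at this
  · exact (happly v (ne_of_mem_erase hv)).resolve_right (hne v hv _ hmem)

/-- Threats at new apices of the core `φ`, made by the edges with index `s`, force the opponent to
reply with the edges with index `t`. The replies do not help him to complete a copy if every core
`ψ` in `B` that can use such a reply has its other side in common with the threat. -/
def IsHarmless (φ : Fin 10 ↪ ℕ) (s t : Fin 9) (B : Finset (CompleteEdge 5)) : Prop :=
  ∀ ψ, OwnsCore ψ B → ∀ s' t', IsApexPair s' t' → side ψ t' = side φ t → side ψ s' = side φ s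

theorem exists_isHarmless (φ : Fin 10 ↪ ℕ) {B : Finset (CompleteEdge 5)} (hC : #C ≤ 8)
    (hBC : ∀ ψ, OwnsCore ψ B → OwnsCore ψ C) :
    ∃ s t, IsApexPair s t ∧ IsHarmless φ s t B := by
  by_contra hcon
  have hst₀ : IsApexPair 0 1 := ⟨by decide, by decide, by decide⟩
  simp only [IsHarmless] at hcon
  push Not at hcon
  obtain ⟨ψ, hψ, s, t, hst, hsame, hdiff⟩ := hcon 0 1 hst₀
  obtain ⟨ψ', hψ', s', t', hst', hsame', -⟩ := hcon 1 0 hst₀.symm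
  have hdisj : Disjoint (side ψ t) (side ψ' t') := by
    rw [hsame, hsame']
    exact hst₀.symm.disjoint_side φ
  obtain ⟨htt', hside⟩ := side_eq_of_disjoint hC (hBC ψ hψ) (hBC ψ' hψ') hst.right hst'.right hdisj
  obtain rfl : t' = s := by
    rcases hst.eq_or_eq_or_mem_core t' with h | h | h
    · exact h
    · exact absurd h.symm htt'.ne
    · exact absurd htt'.right (mem_core.1 h)
  exact hdiff (hside.symm.trans hsame')

end Harmless

/-! ### Perpetual threats -/

/-- All edges of the copy `θ`, except possibly the one with index `e`, have been claimed. -/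
def IsThreat (θ : Fin 10 ↪ ℕ) (e : Fin 9) (B : Finset (CompleteEdge 5)) : Prop :=
  ∀ i ≠ e, copyEdge θ i ∈ B

/-- All threats of the owner of `B` have been answered by the owner of `A`. -/
def Blocks (A B : Finset (CompleteEdge 5)) : Prop :=
  ∀ θ e, IsThreat θ e B → copyEdge θ e ∈ A

section Blocks

variable {A B : Finset (CompleteEdge 5)}

theorem Blocks.not_containsWinningSet (h : Blocks A B) (hAB : Disjoint A B) :
    ¬ ContainsWinningSet winningSets B := by
  intro hB
  obtain ⟨θ, hθ⟩ := containsWinningSet_iff.1 hB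
  exact disjoint_left.1 hAB (h θ 0 fun i _ => hθ i) (hθ 0)

theorem Blocks.not_containsWinningSet_insert (h : Blocks A B) (hAB : Disjoint A B)
    {x : CompleteEdge 5} (hx : x ∉ A) : ¬ ContainsWinningSet winningSets (insert x B) := by
  intro hxB
  obtain ⟨θ, hθ⟩ := containsWinningSet_iff.1 hxB
  by_cases he : ∃ e, copyEdge θ e = x
  · obtain ⟨e, rfl⟩ := he
    exact hx (h θ e fun i hi => mem_of_mem_insert_of_ne (hθ i) ((copyEdge_injective θ).ne hi))
  · exact h.not_containsWinningSet hAB (containsWinningSet_iff.2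
      ⟨θ, fun i => mem_of_mem_insert_of_ne (hθ i) fun hi => he ⟨i, hi⟩⟩)

end Blocks

/-- The edges with index `t` of the copies of `φ` with apices in `Z`. -/
def apexEdges (φ : Fin 10 ↪ ℕ) (t : Fin 9) (Z : Finset ℕ) : Finset (CompleteEdge 5) :=
  Z.image fun z => copyEdge (moveApex φ z) t

theorem mem_apexEdges {φ : Fin 10 ↪ ℕ} {t : Fin 9} {Z : Finset ℕ} {x : CompleteEdge 5} :
    x ∈ apexEdges φ t Z ↔ ∃ z ∈ Z, copyEdge (moveApex φ z) t = x :=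
  mem_image

/-- Starting from the position `A`, `B`, the owner of the core `φ` has threatened by the edges with
index `s` at the new apices in `Z`, and now owns `A'`. -/
structure IsThreatSequence (φ : Fin 10 ↪ ℕ) (s : Fin 9) (A B : Finset (CompleteEdge 5))
    (Z : Finset ℕ) (A' : Finset (CompleteEdge 5)) : Prop where
  subset : A ⊆ A'
  isFreeApex : ∀ z ∈ Z, IsFreeApex φ z
  notMem : ∀ z ∈ Z, ∀ y ∈ B, z ∉ y.1
  threat_mem : ∀ z ∈ Z, copyEdge (moveApex φ z) s ∈ A'

namespace IsThreatSequence

variable {φ θ : Fin 10 ↪ ℕ} {s t : Fin 9} {A A' B : Finset (CompleteEdge 5)} {Z : Finset ℕ}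
  {w : ℕ} {x : CompleteEdge 5}

theorem of_insert (h : IsThreatSequence φ s A B (insert w Z) A') :
    IsThreatSequence φ s A B Z A' where
  subset := h.subset
  isFreeApex z hz := h.isFreeApex z (mem_insert_of_mem hz)
  notMem z hz := h.notMem z (mem_insert_of_mem hz)
  threat_mem z hz := h.threat_mem z (mem_insert_of_mem hz)

theorem eq_of_apex_mem (h : IsThreatSequence φ s A B Z A') (ht : 0 ∈ edge t) {z : ℕ} (hz : z ∈ Z)
    {y : CompleteEdge 5} (hy : y ∈ B ∪ apexEdges φ t Z) (hzy : z ∈ y.1) :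
    y = copyEdge (moveApex φ z) t := by
  rcases mem_union.1 hy with hy | hy
  · exact absurd hzy (h.notMem z hz y hy)
  · obtain ⟨z', hz', rfl⟩ := mem_apexEdges.1 hy
    rw [eq_of_mem_copyEdge_moveApex ht (h.isFreeApex z hz) (h.isFreeApex z' hz') hzy]

theorem apply_zero_eq (h : IsThreatSequence φ s A B Z A') (ht : 0 ∈ edge t)
    (hθ : ∀ j, copyEdge θ j ∈ insert x (B ∪ apexEdges φ t Z)) {z : ℕ} (hz : z ∈ Z) {i : Fin 9}
    (hi : copyEdge (moveApex φ z) t = copyEdge θ i) : θ 0 = z :=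
  apply_zero_eq_of_forall_mem_eq (e := i) (fun j _ => hθ j) (hi ▸ mem_copyEdge_moveApex ht)
    fun _ hy hzy => (h.eq_of_apex_mem ht hz hy hzy).trans hi

theorem ownsCore (h : IsThreatSequence φ s A B Z A') (ht : 0 ∈ edge t)
    (hθ : ∀ j, copyEdge θ j ∈ insert x (B ∪ apexEdges φ t Z)) {j : Fin 9} (hj : 0 ∈ edge j)
    (hjx : copyEdge θ j = x) : OwnsCore θ B := by
  intro k hk
  have hkx : copyEdge θ k ≠ x := fun hkx =>
    mem_core.1 hk (copyEdge_injective θ (hkx.trans hjx.symm) ▸ hj)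
  refine (mem_union.1 (mem_of_mem_insert_of_ne (hθ k) hkx)).resolve_right fun hkZ => ?_
  obtain ⟨z, hz, hzk⟩ := mem_apexEdges.1 hkZ
  have hmem : θ 0 ∈ (copyEdge θ k).1 := by
    rw [h.apply_zero_eq ht hθ hz hzk, ← hzk]
    exact mem_copyEdge_moveApex ht
  exact mem_core.1 hk (mem_copyEdge.1 hmem)

theorem mem_of_copyEdge_mem_apexEdges (h : IsThreatSequence φ s A B Z A')
    (hst : IsApexPair s t) (hharm : IsHarmless φ s t B)
    (hθ : ∀ j, copyEdge θ j ∈ insert x (B ∪ apexEdges φ t Z)) {i : Fin 9}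
    (hi : copyEdge θ i ∈ apexEdges φ t Z) : x ∈ A' := by
  obtain ⟨z, hz, hzi⟩ := mem_apexEdges.1 hi
  have hθ0 : θ 0 = z := h.apply_zero_eq hst.right hθ hz hzi
  have hi0 : 0 ∈ edge i := by
    rw [← mem_copyEdge (θ := θ), hθ0, ← hzi]
    exact mem_copyEdge_moveApex hst.right
  obtain ⟨j, hij⟩ := exists_isApexPair hi0
  have hjx : copyEdge θ j = x := by
    refine (mem_insert.1 (hθ j)).resolve_right fun hj => hij.ne (copyEdge_injective θ ?_)
    rw [h.eq_of_apex_mem hst.right hz hj (hθ0 ▸ mem_copyEdge.2 hij.right), hzi]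
  have hcore : OwnsCore θ B := h.ownsCore hst.right hθ hij.right hjx
  have hapex : moveApex φ z 0 = θ 0 := (moveApex_zero φ z).trans hθ0.symm
  have hfree := h.isFreeApex z hz
  have hside : side θ i = side φ t := by
    rw [← side_moveApex hfree]
    exact ((copyEdge_eq_iff_side_eq hst.right hi0 hapex).1 hzi).symm
  have hside' : side θ j = side φ s := hharm θ hcore j i hij.symm hside
  rw [← hjx, ← (copyEdge_eq_iff_side_eq hst.left hij.right hapex).2
    ((side_moveApex hfree).trans hside'.symm)]
  exact h.threat_mem z hz

theorem not_containsWinningSet_insert (h : IsThreatSequence φ s A B Z A')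
    (hst : IsApexPair s t) (hharm : IsHarmless φ s t B) (hAB : Disjoint A B) (hB : Blocks A B)
    (hx : x ∉ A') : ¬ ContainsWinningSet winningSets (insert x (B ∪ apexEdges φ t Z)) := by
  intro hcopy
  obtain ⟨θ, hθ⟩ := containsWinningSet_iff.1 hcopy
  refine hB.not_containsWinningSet_insert hAB (fun hxA => hx (h.subset hxA))
    (containsWinningSet_iff.2 ⟨θ, fun i => ?_⟩)
  have := hθ i
  rw [← insert_union] at this
  exact (mem_union.1 this).resolve_right fun hi =>
    hx (h.mem_of_copyEdge_mem_apexEdges hst hharm hθ hi)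

theorem exists_insert (h : IsThreatSequence φ s A B Z A') (hst : IsApexPair s t) :
    ∃ w ∉ Z, copyEdge (moveApex φ w) s ∉ A' ∧
      copyEdge (moveApex φ w) s ∉ B ∪ apexEdges φ t Z ∧
      copyEdge (moveApex φ w) t ∉ insert (copyEdge (moveApex φ w) s) A' ∧
      IsThreatSequence φ s A B (insert w Z) (insert (copyEdge (moveApex φ w) s) A') := by
  obtain ⟨w, hw⟩ := Infinite.exists_notMem_finset
    ((A' ∪ (B ∪ apexEdges φ t Z)).biUnion Subtype.val ∪ Z ∪ univ.map φ)
  simp only [mem_union, mem_biUnion, mem_map, mem_univ, true_and, not_or, not_exists,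
    not_and] at hw
  obtain ⟨⟨hclaimed, hwZ⟩, hwφ⟩ := hw
  have hws : w ∈ (copyEdge (moveApex φ w) s).1 := mem_copyEdge_moveApex hst.left
  have hwt : w ∈ (copyEdge (moveApex φ w) t).1 := mem_copyEdge_moveApex hst.right
  refine ⟨w, hwZ, fun hA => hclaimed _ (Or.inl hA) hws,
    fun hB => hclaimed _ (Or.inr (mem_union.1 hB)) hws, fun ht => ?_, ?_⟩
  · rcases mem_insert.1 ht with heq | hA
    · exact hst.ne (copyEdge_injective _ heq).symm
    · exact hclaimed _ (Or.inl hA) hwt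
  · exact
      { subset := h.subset.trans (subset_insert _ _)
        isFreeApex := (forall_mem_insert _ _ _).2 ⟨fun v _ => hwφ v, h.isFreeApex⟩
        notMem := (forall_mem_insert _ _ _).2
          ⟨fun y hy => hclaimed y (Or.inr (Or.inl hy)), h.notMem⟩
        threat_mem := (forall_mem_insert _ _ _).2
          ⟨mem_insert_self _ _, fun z hz => mem_insert_of_mem (h.threat_mem z hz)⟩ }

theorem survives_of_unanswered (h : IsThreatSequence φ s A B (insert w Z) A')
    (hst : IsApexPair s t) (hφ : OwnsCore φ A) :
    Survives winningSets (insert (copyEdge (moveApex φ w) t) A') (insert x (B ∪ apexEdges φ t Z)) :=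
  .of_containsWinningSet <|
    (hφ.mono (h.subset.trans (subset_insert _ _))).containsWinningSet
      (h.isFreeApex w (mem_insert_self _ _)) hst
      (mem_insert_of_mem (h.threat_mem w (mem_insert_self _ _))) (mem_insert_self _ _)

theorem reply_notMem (h : IsThreatSequence φ s A B (insert w Z) A') (ht : 0 ∈ edge t)
    (hw : w ∉ Z) : copyEdge (moveApex φ w) t ∉ B ∪ apexEdges φ t Z := by
  have hwt : w ∈ (copyEdge (moveApex φ w) t).1 := mem_copyEdge_moveApex ht
  have hwmem := mem_insert_self w Z
  refine notMem_union.2 ⟨fun hB => h.notMem w hwmem _ hB hwt, fun hZ => ?_⟩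
  obtain ⟨z, hz, hzw⟩ := mem_apexEdges.1 hZ
  rw [← hzw] at hwt
  exact hw (eq_of_mem_copyEdge_moveApex ht (h.isFreeApex w hwmem)
    (h.isFreeApex z (mem_insert_of_mem hz)) hwt ▸ hz)

theorem survives (h : IsThreatSequence φ s A B (insert w Z) A') (hst : IsApexPair s t)
    (hharm : IsHarmless φ s t B) (hφ : OwnsCore φ A) (hAB : Disjoint A B) (hB : Blocks A B)
    (hw : w ∉ Z) (hwt : copyEdge (moveApex φ w) t ∉ A') :
    Survives winningSets A' (B ∪ apexEdges φ t Z) := by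
  refine Survives.coinduct_upTo (fun A' B' => ∃ Z, ∃ w ∉ Z, B' = B ∪ apexEdges φ t Z ∧
    IsThreatSequence φ s A B (insert w Z) A' ∧ copyEdge (moveApex φ w) t ∉ A') ?_
    ⟨Z, w, hw, rfl, h, hwt⟩
  rintro A' B' ⟨Z, w, hw, rfl, h, hwt⟩ x hxA -
  refine ⟨fun hcopy => absurd hcopy
    (h.of_insert.not_containsWinningSet_insert hst hharm hAB hB hxA), ?_⟩
  by_cases hx : copyEdge (moveApex φ w) t = x
  · have hreply : insert x (B ∪ apexEdges φ t Z) = B ∪ apexEdges φ t (insert w Z) := by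
      rw [apexEdges, apexEdges, image_insert, union_insert, hx]
    rw [hreply]
    obtain ⟨w', hw', hsA, hsB, htA, hnext⟩ := h.exists_insert hst
    exact ⟨_, hsA, hsB, Or.inl ⟨_, w', hw', rfl, hnext, htA⟩⟩
  · refine ⟨_, hwt, ?_, Or.inr (h.survives_of_unanswered hst hφ)⟩
    rw [mem_insert, not_or]
    exact ⟨hx, h.reply_notMem hst.right hw⟩

end IsThreatSequence

theorem survivesToMove_of_ownsCore {φ : Fin 10 ↪ ℕ} {A B C : Finset (CompleteEdge 5)}
    (hφ : OwnsCore φ A) (hAB : Disjoint A B) (hB : Blocks A B) (hC : #C ≤ 8)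
    (hBC : ∀ ψ, OwnsCore ψ B → OwnsCore ψ C) : SurvivesToMove winningSets A B := by
  obtain ⟨s, t, hst, hharm⟩ := exists_isHarmless φ hC hBC
  have hstart : IsThreatSequence φ s A B ∅ A := ⟨subset_rfl, by simp, by simp, by simp⟩
  obtain ⟨w, hw, hsA, hsB, htA, hnext⟩ := hstart.exists_insert hst
  have hempty : B ∪ apexEdges φ t ∅ = B := union_empty B
  have hsurvives := hnext.survives hst hharm hφ hAB hB hw htA
  rw [hempty] at hsB hsurvives
  exact ⟨_, hsA, hsB, hsurvives⟩

/-! ### Answering threats of the opponent -/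

section Counting

variable {θ θ' : Fin 10 ↪ ℕ} {B : Finset (CompleteEdge 5)} {x : CompleteEdge 5} {e : Fin 9}

theorem nine_le_card_of_containsWinningSet (h : ContainsWinningSet winningSets B) : 9 ≤ #B := by
  obtain ⟨θ, hθ⟩ := containsWinningSet_iff.1 h
  calc 9 = #(univ.image (copyEdge θ)) := by
        rw [card_image_of_injective _ (copyEdge_injective θ), card_univ, Fintype.card_fin]
    _ ≤ #B := card_le_card (image_subset_iff.2 fun i _ => hθ i)

theorem IsThreat.seven_le_card (h : IsThreat θ e (insert x B)) :
    7 ≤ #{i | copyEdge θ i ∈ B} := by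
  have hcard : #univ ≤ #{i | copyEdge θ i ∈ B} + #{x, copyEdge θ e} :=
    card_le_card_filter_add_card (copyEdge_injective θ) fun i _ => by
      rw [mem_insert, mem_singleton]
      by_cases hi : i = e
      · exact Or.inl (Or.inr (congrArg _ hi))
      · exact (mem_insert.1 (h i hi)).imp_left Or.inl
  have htwo := card_le_two (a := x) (b := copyEdge θ e)
  rw [card_univ, Fintype.card_fin] at hcard
  lia

theorem OwnsCore.six_le_card (h : OwnsCore θ (insert x B)) :
    6 ≤ #{i ∈ core | copyEdge θ i ∈ B} := by
  have hcard : #core ≤ #{i ∈ core | copyEdge θ i ∈ B} + #{x} :=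
    card_le_card_filter_add_card (copyEdge_injective θ) fun i hi => by
      rw [mem_singleton]
      exact mem_insert.1 (h i hi)
  rw [card_core, card_singleton] at hcard
  lia

theorem IsThreat.exists_eq_of_card_le (h : IsThreat θ e B) (hB : #B ≤ 8) :
    ∀ y ∈ B, ∃ i ≠ e, y = copyEdge θ i := by
  intro y hy
  have himage : (univ.erase e).image (copyEdge θ) = B := by
    refine eq_of_subset_of_card_le
      (image_subset_iff.2 fun i hi => h i (ne_of_mem_erase hi)) (hB.trans_eq ?_)
    rw [card_image_of_injective _ (copyEdge_injective θ), card_erase_of_mem (mem_univ e),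
      card_univ, Fintype.card_fin]
  rw [← himage] at hy
  obtain ⟨i, hi, rfl⟩ := mem_image.1 hy
  exact ⟨i, ne_of_mem_erase hi, rfl⟩

theorem card_insert_image_le (θ : Fin 10 ↪ ℕ) (x : CompleteEdge 5) {K : Finset (Fin 9)}
    (hK : K ⊆ core) : #(insert x (K.image (copyEdge θ))) ≤ 8 :=
  calc #(insert x (K.image (copyEdge θ))) ≤ #(K.image (copyEdge θ)) + 1 := card_insert_le _ _
    _ = #K + 1 := by rw [card_image_of_injective _ (copyEdge_injective θ)]
    _ ≤ #core + 1 := Nat.succ_le_succ (card_le_card hK)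
    _ = 8 := by rw [card_core]

end Counting

section CoreEdge

variable {φ θ ψ : Fin 10 ↪ ℕ} {A B : Finset (CompleteEdge 5)} {x : CompleteEdge 5} {e : Fin 9}

theorem blocks_insert_of_core_edge (he : e ∈ core) (hB : ∀ y ∈ B, ∃ i ≠ e, y = copyEdge θ i)
    (heA : copyEdge θ e ∈ A) (hx : x ∉ A) : Blocks A (insert x B) := by
  intro θ' e' h
  have hK := h.seven_le_card
  have heq := copyEdge_eq_of_seven_le (θ := θ) hK fun i hi =>
    (hB _ (mem_filter.1 hi).2).imp fun _ => And.right
  have hapex : ∃ i ∈ ({i | copyEdge θ' i ∈ B} : Finset (Fin 9)), 0 ∈ edge i := by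
    by_contra! hcon
    have hsub : ({i | copyEdge θ' i ∈ B} : Finset (Fin 9)) ⊆ core.erase e := fun i hi => by
      obtain ⟨j, hj, hij⟩ := hB _ (mem_filter.1 hi).2
      rw [heq i hi] at hij
      exact mem_erase.2 ⟨copyEdge_injective θ hij ▸ hj, mem_core.2 (hcon i hi)⟩
    have hcard := card_le_card hsub
    rw [card_erase_of_mem he, card_core] at hcard
    lia
  obtain rfl : θ' = θ := by
    refine DFunLike.ext _ _ fun v => ?_
    by_cases hv : v = 0
    · exact apply_eq_of_seven_le hK heq (hv ▸ hapex)
    · exact apply_eq_of_seven_le_of_ne_zero hK heq hv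
  by_cases hee' : e = e'
  · exact hee' ▸ heA
  · obtain ⟨j, hj, hej⟩ := hB _ (mem_of_mem_insert_of_ne (h e hee') fun hex => hx (hex ▸ heA))
    exact absurd (copyEdge_injective θ' hej).symm hj

theorem OwnsCore.subset_of_core_edge (hB : ∀ y ∈ B, ∃ i ≠ e, y = copyEdge θ i)
    (hψ : OwnsCore ψ (insert x B)) :
    OwnsCore ψ (insert x ((core.erase e).image (copyEdge θ))) := by
  obtain ⟨τ, -, hτ⟩ := exists_coreSymmetry_of_six_le (filter_subset _ _) hψ.six_le_card
    (θ := θ) fun i hi => (hB _ (mem_filter.1 hi).2).imp fun _ => And.right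
  intro i hi
  refine mem_insert.2 ((mem_insert.1 (hψ i hi)).imp_right fun hiB => ?_)
  obtain ⟨j, hj, -, hij⟩ := hτ i (mem_filter.2 ⟨hi, hiB⟩)
  obtain ⟨k, hk, hik⟩ := hB _ hiB
  rw [hij] at hik ⊢
  exact mem_image_of_mem _ (mem_erase.2 ⟨copyEdge_injective θ hik ▸ hk, hj⟩)

theorem survives_of_core_edge (hφ : OwnsCore φ A) (hAB : Disjoint A B) (he : e ∈ core)
    (hB : ∀ y ∈ B, ∃ i ≠ e, y = copyEdge θ i) (heA : copyEdge θ e ∈ A) :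
    Survives winningSets A B := by
  refine survives_iff.2 fun x hxA _ => ?_
  have hdisj : Disjoint A (insert x B) := disjoint_insert_right.2 ⟨hxA, hAB⟩
  have hblocks := blocks_insert_of_core_edge he hB heA hxA
  exact ⟨fun h => absurd h (hblocks.not_containsWinningSet hdisj),
    survivesToMove_of_ownsCore hφ hdisj hblocks
      (card_insert_image_le θ x (erase_subset e core)) fun _ hψ => hψ.subset_of_core_edge hB⟩

end CoreEdge

/-- `x` is one of the two edges at the apex `z` of a copy with the same core as `θ`, and the other
one has been claimed in `A`. -/
def IsBlockedAt (θ : Fin 10 ↪ ℕ) (A : Finset (CompleteEdge 5)) (x : CompleteEdge 5) (z : ℕ) :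
    Prop :=
  ∃ s t, IsApexPair s t ∧ IsFreeApex θ z ∧ x = copyEdge (moveApex θ z) s ∧
    copyEdge (moveApex θ z) t ∈ A

/-- The owner of `B` only has edges of the core of `θ` and blocked edges at apices of this core. -/
structure IsApexPosition (θ : Fin 10 ↪ ℕ) (A B : Finset (CompleteEdge 5)) : Prop where
  disjoint : Disjoint A B
  core_or_blocked : ∀ y ∈ B, (∃ j ∈ core, y = copyEdge θ j) ∨ ∃ z, IsBlockedAt θ A y z

section Apex

variable {φ θ θ' ψ : Fin 10 ↪ ℕ} {A A' B : Finset (CompleteEdge 5)} {x y : CompleteEdge 5} {z : ℕ}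
  {s e i : Fin 9}

theorem IsBlockedAt.mono (h : IsBlockedAt θ A x z) (hA : A ⊆ A') : IsBlockedAt θ A' x z :=
  let ⟨s, t, hst, hz, hx, ht⟩ := h
  ⟨s, t, hst, hz, hx, hA ht⟩

theorem IsBlockedAt.apex_mem (h : IsBlockedAt θ A x z) : z ∈ x.1 := by
  obtain ⟨s, t, hst, -, rfl, -⟩ := h
  exact mem_copyEdge_moveApex hst.left

theorem IsApexPair.isBlockedAt (h : IsApexPair s e) (hθ : ∀ v ≠ 0, θ' v = θ v)
    (he : copyEdge θ' e ∈ A) : IsBlockedAt θ A (copyEdge θ' s) (θ' 0) := by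
  exact ⟨s, e, h, (isFreeApex_apply_zero θ').congr hθ, by rw [← eq_moveApex hθ],
    by rwa [← eq_moveApex hθ]⟩

theorem IsThreat.exists_isApexPair_copyEdge_eq (h : IsThreat θ e (insert x B))
    (hB : ∀ i ∉ core, copyEdge θ i ∉ B) : ∃ s, IsApexPair s e ∧ copyEdge θ s = x := by
  have hx : ∀ s, 0 ∈ edge s → s ≠ e → copyEdge θ s = x := fun s hs hse =>
    (mem_insert.1 (h s hse)).resolve_right (hB s fun hcore => mem_core.1 hcore hs)
  have he : 0 ∈ edge e := by
    by_contra he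
    have h0 := hx 0 (by decide) fun h0 => he (h0 ▸ by decide)
    have h1 := hx 1 (by decide) fun h1 => he (h1 ▸ by decide)
    exact absurd (copyEdge_injective θ (h0.trans h1.symm)) (by decide)
  obtain ⟨s, hs⟩ := exists_isApexPair he
  exact ⟨s, hs.symm, hx s hs.right hs.ne.symm⟩

namespace IsApexPosition

theorem eq_of_apex_mem (h : IsApexPosition θ A B) (hx : IsBlockedAt θ A x z) (hy : y ∈ B)
    (hz : z ∈ y.1) : y = x := by
  obtain ⟨s, t, hst, hzθ, rfl, ht⟩ := hx
  rcases h.core_or_blocked y hy with ⟨i, hi, rfl⟩ | ⟨z', s', t', hst', hzθ', rfl, -⟩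
  · obtain ⟨v, hv, hvz⟩ := mem_map.1 hz
    exact absurd hvz (hzθ v (ne_of_mem_of_not_mem hv (mem_core.1 hi)))
  · obtain rfl := eq_of_mem_copyEdge_moveApex hst'.left hzθ hzθ' hz
    rcases hst.eq_or_eq_or_mem_core s' with rfl | rfl | hs'
    · rfl
    · exact absurd hy (disjoint_left.1 h.disjoint ht)
    · exact absurd hst'.left (mem_core.1 hs')

theorem apply_zero_eq (h : IsApexPosition θ A B) (hθ' : IsThreat θ' e (insert x B))
    (hi : IsBlockedAt θ A (copyEdge θ' i) z) : θ' 0 = z :=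
  apply_zero_eq_of_forall_mem_eq hθ' hi.apex_mem fun _ hy hz => h.eq_of_apex_mem hi hy hz

theorem mem_of_isBlockedAt (h : IsApexPosition θ A B) (hx : x ∉ A)
    (hθ' : IsThreat θ' e (insert x B)) (hi : IsBlockedAt θ A (copyEdge θ' i) z) :
    copyEdge θ' e ∈ A := by
  obtain rfl := h.apply_zero_eq hθ' hi
  obtain ⟨s, t, -, hfree, -, ht⟩ := hi
  have heq := copyEdge_eq_of_seven_le (θ := moveApex θ (θ' 0)) hθ'.seven_le_card fun k hk => by
    rcases h.core_or_blocked _ (mem_filter.1 hk).2 with ⟨j, hj, hkj⟩ | ⟨z, hkz⟩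
    · exact ⟨j, hkj.trans (copyEdge_moveApex_of_mem_core hfree hj).symm⟩
    · obtain rfl := h.apply_zero_eq hθ' hkz
      obtain ⟨s', -, -, -, hks, -⟩ := hkz
      exact ⟨s', hks⟩
  rw [← eq_moveApex fun v hv => (apply_eq_of_seven_le_of_ne_zero hθ'.seven_le_card heq hv).trans
    (moveApex_of_ne hfree hv)] at ht
  by_cases hte : t = e
  · exact hte ▸ ht
  · rcases mem_insert.1 (hθ' t hte) with htx | htB
    · exact absurd ht (htx ▸ hx)
    · exact absurd htB (disjoint_left.1 h.disjoint ht)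

theorem eq_core_of_forall_not_isBlockedAt (h : IsApexPosition θ A B)
    (hθ' : IsThreat θ' e (insert x B)) (hnew : ∀ i z, ¬ IsBlockedAt θ A (copyEdge θ' i) z) :
    (∀ v ≠ 0, θ' v = θ v) ∧ ({i | copyEdge θ' i ∈ B} : Finset (Fin 9)) = core := by
  have hK := hθ'.seven_le_card
  have hcore : ∀ i ∈ ({i | copyEdge θ' i ∈ B} : Finset (Fin 9)),
      ∃ j ∈ core, copyEdge θ' i = copyEdge θ j := fun i hi =>
    (h.core_or_blocked _ (mem_filter.1 hi).2).resolve_right (not_exists.2 (hnew i))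
  have heq := copyEdge_eq_of_seven_le hK fun i hi => (hcore i hi).imp fun _ => And.right
  refine ⟨fun v hv => apply_eq_of_seven_le_of_ne_zero hK heq hv,
    eq_of_subset_of_card_le (fun i hi => ?_) (by rwa [card_core])⟩
  obtain ⟨j, hj, hij⟩ := hcore i hi
  rwa [copyEdge_injective θ ((heq i hi).symm.trans hij)]

theorem mem_or_exists_isBlockedAt (h : IsApexPosition θ A B) (hx : x ∉ A)
    (hθ' : IsThreat θ' e (insert x B)) : copyEdge θ' e ∈ A ∨ copyEdge θ' e ∉ insert x B ∧
      ∃ z, IsBlockedAt θ (insert (copyEdge θ' e) A) x z := by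
  by_cases hnew : ∀ i z, ¬ IsBlockedAt θ A (copyEdge θ' i) z
  · right
    obtain ⟨hv, hK⟩ := h.eq_core_of_forall_not_isBlockedAt hθ' hnew
    have hB : ∀ i ∉ core, copyEdge θ' i ∉ B := fun i hi hiB =>
      hi (hK ▸ mem_filter.2 ⟨mem_univ i, hiB⟩)
    obtain ⟨s, hse, rfl⟩ := hθ'.exists_isApexPair_copyEdge_eq hB
    refine ⟨fun he => ?_, θ' 0, hse.isBlockedAt hv (mem_insert_self _ _)⟩
    rcases mem_insert.1 he with hes | heB
    · exact hse.ne (copyEdge_injective θ' hes).symm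
    · exact hB e (fun he => mem_core.1 he hse.right) heB
  · push Not at hnew
    obtain ⟨i, z, hi⟩ := hnew
    exact Or.inl (h.mem_of_isBlockedAt hx hθ' hi)

theorem not_containsWinningSet_insert (h : IsApexPosition θ A B) (hx : x ∉ A) :
    ¬ ContainsWinningSet winningSets (insert x B) := by
  intro hcopy
  obtain ⟨θ', hθ'⟩ := containsWinningSet_iff.1 hcopy
  rcases h.mem_or_exists_isBlockedAt hx (e := 0) fun i _ => hθ' i with hA | ⟨hB, -⟩
  · exact disjoint_left.1 (disjoint_insert_right.2 ⟨hx, h.disjoint⟩) hA (hθ' 0)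
  · exact hB (hθ' 0)

theorem insert_of_isBlockedAt (h : IsApexPosition θ A B) (hx : x ∉ A) (hy : y ∉ insert x B)
    (hxy : ∃ z, IsBlockedAt θ (insert y A) x z) :
    IsApexPosition θ (insert y A) (insert x B) where
  disjoint := disjoint_insert_left.2 ⟨hy, disjoint_insert_right.2 ⟨hx, h.disjoint⟩⟩
  core_or_blocked := (forall_mem_insert _ _ _).2 ⟨Or.inr hxy, fun w hw =>
    (h.core_or_blocked w hw).imp_right fun ⟨z, hz⟩ => ⟨z, hz.mono (subset_insert _ _)⟩⟩

theorem ownsCore (h : IsApexPosition θ A B) (hψ : OwnsCore ψ (insert x B)) :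
    OwnsCore ψ (insert x (core.image (copyEdge θ))) := by
  intro i hi
  refine mem_insert.2 ((mem_insert.1 (hψ i hi)).imp_right fun hiB => ?_)
  rcases h.core_or_blocked _ hiB with ⟨j, hj, hij⟩ | ⟨z, hz⟩
  · exact hij ▸ mem_image_of_mem _ hj
  · exact absurd (fun y hy hzy => h.eq_of_apex_mem hz hy hzy)
      (hψ.not_forall_mem_eq hi hz.apex_mem)

theorem survives (h : IsApexPosition θ A B) (hφ : OwnsCore φ A) : Survives winningSets A B := by
  refine Survives.coinduct_upTo (fun A B => OwnsCore φ A ∧ IsApexPosition θ A B) ?_ ⟨hφ, h⟩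
  rintro A B ⟨hφ, h⟩ x hxA -
  refine ⟨fun hcopy => absurd hcopy (h.not_containsWinningSet_insert hxA), ?_⟩
  by_cases hblocks : Blocks A (insert x B)
  · obtain ⟨y, hyA, hyB, hy⟩ := survivesToMove_of_ownsCore hφ
      (disjoint_insert_right.2 ⟨hxA, h.disjoint⟩) hblocks (card_insert_image_le θ x subset_rfl)
      fun _ hψ => h.ownsCore hψ
    exact ⟨y, hyA, hyB, Or.inr hy⟩
  · rw [Blocks] at hblocks
    push Not at hblocks
    obtain ⟨θ', e, hθ', heA⟩ := hblocks
    obtain ⟨heB, hx⟩ := (h.mem_or_exists_isBlockedAt hxA hθ').resolve_left heA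
    exact ⟨copyEdge θ' e, heA, heB,
      Or.inl ⟨hφ.mono (subset_insert _ _), h.insert_of_isBlockedAt hxA heB hx⟩⟩

end IsApexPosition

theorem isApexPosition_of_forall_eq (hAB : Disjoint A B) (h : IsApexPair s e)
    (hB : ∀ y ∈ B, ∃ i ≠ e, y = copyEdge θ i) (he : copyEdge θ e ∈ A) :
    IsApexPosition θ A B where
  disjoint := hAB
  core_or_blocked y hy := by
    obtain ⟨i, hi, rfl⟩ := hB y hy
    rcases h.eq_or_eq_or_mem_core i with rfl | rfl | hcore
    · exact Or.inr ⟨θ 0, h.isBlockedAt (fun _ _ => rfl) he⟩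
    · exact absurd rfl hi
    · exact Or.inl ⟨i, hcore, rfl⟩

end Apex

section SevenEdges

variable {φ θ : Fin 10 ↪ ℕ} {A B : Finset (CompleteEdge 5)} {e : Fin 9}

theorem survives_of_forall_eq (hφ : OwnsCore φ A) (hAB : Disjoint A B)
    (hB : ∀ y ∈ B, ∃ i ≠ e, y = copyEdge θ i) (he : copyEdge θ e ∈ A) :
    Survives winningSets A B := by
  by_cases hcore : e ∈ core
  · exact survives_of_core_edge hφ hAB hcore hB he
  · rw [mem_core, not_not] at hcore
    obtain ⟨s, hs⟩ := exists_isApexPair hcore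
    exact (isApexPosition_of_forall_eq hAB hs.symm hB he).survives hφ

theorem survivesToMove_of_card_le (hφ : OwnsCore φ A) (hAB : Disjoint A B) (hB : #B ≤ 8) :
    SurvivesToMove winningSets A B := by
  by_cases hblocks : Blocks A B
  · exact survivesToMove_of_ownsCore hφ hAB hblocks hB fun _ hψ => hψ
  · rw [Blocks] at hblocks
    push Not at hblocks
    obtain ⟨θ, e, hθ, heA⟩ := hblocks
    have hedges := hθ.exists_eq_of_card_le hB
    have heB : copyEdge θ e ∉ B := fun heB => by
      obtain ⟨i, hi, hei⟩ := hedges _ heB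
      exact hi (copyEdge_injective θ hei).symm
    exact ⟨copyEdge θ e, heA, heB, survives_of_forall_eq (hφ.mono (subset_insert _ _))
      (disjoint_insert_left.2 ⟨heB, hAB⟩) hedges (mem_insert_self _ _)⟩

end SevenEdges

/-! ### Building the core -/

section Building

variable {φ : Fin 10 ↪ ℕ} {A B : Finset (CompleteEdge 5)}

theorem survives_of_card_lt (hB : #B < 8)
    (reply : ∀ x ∉ A, x ∉ B → SurvivesToMove winningSets A (insert x B)) :
    Survives winningSets A B := by
  refine survives_iff.2 fun x hxA hxB => ⟨fun hcopy => ?_, reply x hxA hxB⟩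
  have hnine := nine_le_card_of_containsWinningSet hcopy
  have hinsert := card_insert_le x B
  lia

theorem survives_of_ownsCore (hφ : OwnsCore φ A) (hAB : Disjoint A B) (hB : #B ≤ 7) :
    Survives winningSets A B :=
  survives_of_card_lt (Nat.lt_succ_of_le hB) fun x hxA _ =>
    survivesToMove_of_card_le hφ (disjoint_insert_right.2 ⟨hxA, hAB⟩)
      ((card_insert_le x B).trans (Nat.succ_le_succ hB))

theorem survivesToMove_of_last_core_edge (hA : ∀ i, 3 ≤ i → copyEdge φ i ∈ A)
    (hAB : Disjoint A B) (hB : #B ≤ 7) (h : copyEdge φ 2 ∉ A ∪ B) :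
    SurvivesToMove winningSets A B := by
  obtain ⟨hnA, hnB⟩ := notMem_union.1 h
  refine ⟨copyEdge φ 2, hnA, hnB,
    survives_of_ownsCore (φ := φ) (fun i hi => ?_) (disjoint_insert_left.2 ⟨hnB, hAB⟩) hB⟩
  rcases (show ∀ i ∈ core, i = 2 ∨ 3 ≤ i by decide) i hi with rfl | hi
  · exact mem_insert_self _ _
  · exact mem_insert_of_mem (hA i hi)

theorem copyEdge_cycleReflection_mem (hA : ∀ i, 3 ≤ i → copyEdge φ i ∈ A) :
    ∀ i, 3 ≤ i → copyEdge (cycleReflection.toEmbedding.trans φ) i ∈ A := by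
  have reflect : ∀ i : Fin 9, 3 ≤ i →
      ∃ j, 3 ≤ j ∧ (edge i).map cycleReflection.toEmbedding = edge j := by decide
  intro i hi
  obtain ⟨j, hj, hij⟩ := reflect i hi
  rw [copyEdge_trans hij]
  exact hA j hj

theorem survives_of_two_last_core_edges (hA : ∀ i, 3 ≤ i → copyEdge φ i ∈ A)
    (hAB : Disjoint A B) (hB : #B ≤ 6) (h : copyEdge φ 2 ∉ A ∪ B)
    (h' : copyEdge (cycleReflection.toEmbedding.trans φ) 2 ∉ A ∪ B) :
    Survives winningSets A B := by
  refine survives_of_card_lt (by lia) fun x hxA _ => ?_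
  have hdisj : Disjoint A (insert x B) := disjoint_insert_right.2 ⟨hxA, hAB⟩
  have hcard : #(insert x B) ≤ 7 := (card_insert_le x B).trans (Nat.succ_le_succ hB)
  by_cases hx : copyEdge φ 2 = x
  · refine survivesToMove_of_last_core_edge (copyEdge_cycleReflection_mem hA) hdisj hcard ?_
    rw [union_insert, mem_insert, not_or]
    refine ⟨fun hx' => ?_, h'⟩
    have hmap : (edge 2).map (cycleReflection.toEmbedding.trans φ) = (edge 2).map φ :=
      congrArg Subtype.val (hx'.trans hx.symm)
    rw [← map_map] at hmap
    exact absurd (map_injective φ hmap) (by decide)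
  · refine survivesToMove_of_last_core_edge hA hdisj hcard ?_
    rw [union_insert, mem_insert, not_or]
    exact ⟨hx, h⟩

/-- The edges that are used to continue from the tight path with the edges `4, …, 8` to a core. -/
def closingEdges : Finset (Finset (Fin 10)) :=
  {edge 2, edge 3, (edge 2).map cycleReflection.toEmbedding}

theorem survivesToMove_of_closingEdges (hA : ∀ i, 4 ≤ i → copyEdge φ i ∈ A)
    (hAB : Disjoint A B) (hB : #B ≤ 6) (hfree : ∀ d ∈ closingEdges, ∀ y ∈ A ∪ B, y.1 ≠ d.map φ) :
    SurvivesToMove winningSets A B := by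
  obtain ⟨hnA, hnB⟩ : copyEdge φ 3 ∉ A ∧ copyEdge φ 3 ∉ B :=
    notMem_union.1 fun h => hfree (edge 3) (by decide) _ h rfl
  refine ⟨copyEdge φ 3, hnA, hnB, survives_of_two_last_core_edges (φ := φ) (fun i hi => ?_)
    (disjoint_insert_left.2 ⟨hnB, hAB⟩) hB ?_ ?_⟩
  · rcases (show ∀ i : Fin 9, 3 ≤ i → i = 3 ∨ 4 ≤ i by decide) i hi with rfl | hi
    · exact mem_insert_self _ _
    · exact mem_insert_of_mem (hA i hi)
  · rw [insert_union, mem_insert, not_or]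
    exact ⟨(copyEdge_injective φ).ne (by decide), fun h => hfree (edge 2) (by decide) _ h rfl⟩
  · rw [insert_union, mem_insert, not_or]
    refine ⟨fun h => ?_, fun h => hfree ((edge 2).map cycleReflection.toEmbedding) (by decide) _ h
      (by rw [map_map]; rfl)⟩
    rw [← copyEdge_trans (show (edge 8).map cycleReflection.toEmbedding = edge 3 by decide)] at h
    exact absurd (copyEdge_injective _ h) (by decide)

/-- The reversal of the tight path with the edges `4, …, 8`. -/
def pathReversal : Equiv.Perm (Fin 10) :=
  Function.Involutive.toPerm ![0, 9, 8, 7, 6, 5, 4, 3, 2, 1] fun v => by decide +revert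

theorem copyEdge_pathReversal_mem (hA : ∀ i, 4 ≤ i → copyEdge φ i ∈ A) :
    ∀ i, 4 ≤ i → copyEdge (pathReversal.toEmbedding.trans φ) i ∈ A := by
  have reverse : ∀ i : Fin 9, 4 ≤ i →
      ∃ j, 4 ≤ j ∧ (edge i).map pathReversal.toEmbedding = edge j := by decide
  intro i hi
  obtain ⟨j, hj, hij⟩ := reverse i hi
  rw [copyEdge_trans hij]
  exact hA j hj

theorem survives_of_path (hA : ∀ i, 4 ≤ i → copyEdge φ i ∈ A) (hAB : Disjoint A B)
    (hB : #B ≤ 5) (hends : ∀ y ∈ A ∪ B, φ 1 ∈ y.1 → φ 9 ∉ y.1) : Survives winningSets A B := by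
  refine survives_of_card_lt (by lia) fun x hxA _ => ?_
  have hdisj : Disjoint A (insert x B) := disjoint_insert_right.2 ⟨hxA, hAB⟩
  have hcard : #(insert x B) ≤ 6 := (card_insert_le x B).trans (Nat.succ_le_succ hB)
  have hfree : ∀ d : Finset (Fin 10), 1 ∈ d → 9 ∈ d → ∀ y ∈ A ∪ B, y.1 ≠ d.map φ :=
    fun d h1 h9 y hy hyd => hends y hy (hyd ▸ mem_map_of_mem φ h1) (hyd ▸ mem_map_of_mem φ h9)
  by_cases hx : ∃ d ∈ closingEdges, x.1 = d.map φ
  · obtain ⟨d, hd, hxd⟩ := hx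
    have reversed : ∀ d ∈ closingEdges, 1 ∈ d.map pathReversal.toEmbedding ∧
        9 ∈ d.map pathReversal.toEmbedding ∧ d.map pathReversal.toEmbedding ∉ closingEdges := by
      decide +kernel
    refine survivesToMove_of_closingEdges (copyEdge_pathReversal_mem hA) hdisj hcard
      fun d' hd' y hy => ?_
    obtain ⟨h1, h9, hnot⟩ := reversed d' hd'
    rw [← map_map]
    rw [union_insert] at hy
    rcases mem_insert.1 hy with rfl | hy
    · rw [hxd]
      exact fun heq => hnot (map_injective φ heq ▸ hd)
    · exact hfree _ h1 h9 y hy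
  · push Not at hx
    have ends : ∀ d ∈ closingEdges, 1 ∈ d ∧ 9 ∈ d := by decide +kernel
    refine survivesToMove_of_closingEdges hA hdisj hcard fun d hd y hy => ?_
    rw [union_insert] at hy
    rcases mem_insert.1 hy with rfl | hy
    · exact hx d hd
    · exact hfree d (ends d hd).1 (ends d hd).2 y hy

theorem exists_fresh_apply (φ : Fin 10 ↪ ℕ) (v : Fin 10) (S : Finset (CompleteEdge 5)) :
    ∃ χ : Fin 10 ↪ ℕ, (∀ u ≠ v, χ u = φ u) ∧ ∀ y ∈ S, χ v ∉ y.1 := by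
  obtain ⟨w, hw⟩ := Infinite.exists_notMem_finset (S.biUnion Subtype.val ∪ univ.map φ)
  simp only [mem_union, mem_biUnion, mem_map, mem_univ, true_and, not_or, not_exists,
    not_and] at hw
  refine ⟨φ.setValue v w, fun u hu => Function.Embedding.setValue_eq_of_ne hu (hw.2 u), ?_⟩
  rw [Function.Embedding.setValue_eq]
  exact hw.1

theorem natAdd_mem_edge_and_forall_notMem : ∀ k : Fin 5,
    Fin.natAdd 5 k ∈ edge (Fin.natAdd 4 k) ∧
      ∀ j : Fin 9, 4 ≤ j → j.val < 4 + k.val → Fin.natAdd 5 k ∉ edge j := by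
  decide

theorem survives_of_initial_path {k : ℕ} (hk : k ≤ 5)
    (hA : ∀ i : Fin 9, 4 ≤ i → i < 4 + k → copyEdge φ i ∈ A) (hAB : Disjoint A B)
    (hB : #B ≤ k) (hends : k = 5 → ∀ y ∈ A ∪ B, φ 1 ∈ y.1 → φ 9 ∉ y.1) :
    Survives winningSets A B := by
  induction hk using Nat.decreasingInduction generalizing φ A B with
  | self => exact survives_of_path (fun i hi => hA i hi i.2) hAB hB (hends rfl)
  | of_succ k hk ih =>
    refine survives_of_card_lt (by lia) fun x hxA _ => ?_
    obtain ⟨hmem, hnew⟩ := natAdd_mem_edge_and_forall_notMem ⟨k, hk⟩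
    obtain ⟨χ, hχ, hfresh⟩ := exists_fresh_apply φ (Fin.natAdd 5 ⟨k, hk⟩) (A ∪ insert x B)
    obtain ⟨hnA, hnB⟩ := notMem_union.1 fun h => hfresh _ h (mem_copyEdge.2 hmem)
    refine ⟨copyEdge χ (Fin.natAdd 4 ⟨k, hk⟩), hnA, hnB, ih (φ := χ) (fun j hj hjk => ?_)
      (disjoint_insert_left.2 ⟨hnB, disjoint_insert_right.2 ⟨hxA, hAB⟩⟩)
      ((card_insert_le x B).trans (Nat.succ_le_succ hB)) fun hk5 y hy h1 h9 => ?_⟩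
    · by_cases hjk' : j.val < 4 + k
      · rw [copyEdge_congr fun u hu => hχ u (ne_of_mem_of_not_mem hu (hnew j hj hjk'))]
        exact mem_insert_of_mem (hA j hj hjk')
      · obtain rfl : j = Fin.natAdd 4 ⟨k, hk⟩ := Fin.ext (by simp only [Fin.val_natAdd]; lia)
        exact mem_insert_self _ _
    · obtain rfl : k = 4 := by lia
      rw [insert_union] at hy
      rcases mem_insert.1 hy with rfl | hy
      · exact absurd (mem_copyEdge.1 h1) (show 1 ∉ edge 8 by decide)
      · exact hfresh y hy h9

theorem survives_empty (A : Finset (CompleteEdge 5)) : Survives winningSets A ∅ :=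
  survives_of_initial_path (φ := Fin.valEmbedding) (Nat.zero_le 5)
    (fun _ hi hi' => absurd hi' (not_lt.2 hi)) (disjoint_empty_right A) (Nat.zero_le 0)
    fun h => absurd h (by decide)

end Building

theorem isDraw : IsDraw winningSets :=
  isDraw_of_survives ⟨copyEdge Fin.valEmbedding 0, notMem_empty _, notMem_empty _, survives_empty _⟩
    (survives_empty ∅)

end drawHypergraph

theorem theorem1 :
    drawHypergraph.IsUniform 5 ∧
      drawHypergraph.vertexSet.ncard = 10 ∧
      drawHypergraph.edgeSet.ncard = 9 ∧
      IsDraw (ramseyWinningSets 5 drawHypergraph) :=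
  ⟨drawHypergraph.isUniform, drawHypergraph.ncard_vertexSet, drawHypergraph.ncard_edgeSet,
    drawHypergraph.isDraw⟩
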